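/- **Setting.** For $f,g\in\mathbb F_2^n$ let $|f|$ be the weight, $(f,g)=\sum_j f_jg_j \bmod 2$, and for a one-qubit operator $O$ let $O(f)=O^{f_1}\otimes\cdots\otimes O^{f_n}$. Put $S=\mathrm{diag}(1,i)$, $T=\mathrm{diag}(1,e^{i\pi/4})$, $A=e^{-i\pi/4}SX=TXT^\dagger$, $|A_0\rangle=|A\rangle=T|+\rangle$, $|A_1\rangle=Z|A\rangle$, and $\rho=(1-p)|A_0\rangle\langle A_0|+p|A_1\rangle\langle A_1|$ with $0\le p\le 1$. Let $G$ be a triorthogonal binary $m\times n$ matrix (any two and any three distinct rows have even overlap) whose first $k$ rows $f^1,\dots,f^k$ have odd weight and whose other rows have even weight. Let $\mathcal G$ be the row space of $G$, $\mathcal G_0$ the span of the even-weight rows, $|G\rangle=\sum_{g\in\mathcal G}|g\rangle$, $|G_0\rangle=\sum_{g\in\mathcal G_0}|g\rangle$. Let $\mathcal Q$ be the code with stabilizers $X(f)$, $f\in\mathcal G_0$, and $Z(g)$, $g\in\mathcal G^\perp$, with encoded basis states $|\overline x\rangle=|\mathcal G_0|^{-1/2}X(\sum_a x_af^a)|G_0\rangle$,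 $x\in\mathbb F_2^k$. Let $U$ be a product of controlled-$Z$ and $S$ gates with $U\,T^{\otimes n}|G\rangle=\prod_{a=1}^k(I+e^{i\pi/4}X(f^a))|G_0\rangle$. A decoder is a Clifford unitary that maps every $|\overline x\rangle$ to $|x\rangle$ on $k$ chosen qubits and $|0\rangle$ on the other $n-k$, followed by discarding those $n-k$ qubits. *Main subroutine.* Start with the normalized state $|G\rangle$; apply to every qubit the noisy $T$-gate $\mathcal E\circ\mathcal T$, where $\mathcal T(\eta)=T\eta T^\dagger$ and $\mathcal E(\eta)=(1-p)\eta+pZ\eta Z$; apply $U$; measure $X(f)$ for all even-weight rows $f$ of $G$ and fail unless all outcomes are $+1$; decode. *Alternative subroutine*, with input $\rho^{\otimes n}$: 1. Measure $Z(f)$ for $f$ in a basis of $\mathcal G^\perp$, with outcomes $(-1)^{\mu(f)}$. 2. Choose any $w\in\mathbb F_2^n$ with $(w,f)=\mu(f)$ for these $f$, and apply $A(w)^\dagger$. 3. Apply $U$. 4. Measure $X(g)$ for $g$ in a basis of $\mathcal G_0$; fail unless all outcomes are $+1$. 5. Decode. **Theorem.** For every such $G$ all these choices (bases, $w$ for each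 outcome $\mu$, $U$, decoder) can be made. Whatever choices are made, the alternative subroutine consists of Clifford unitaries and Pauli measurements on the $n$ input qubits only (no extra qubits), the number of Pauli measurements it makes (maximum over all outcomes) is $n-k$, and for every $p\in[0,1]$ it succeeds with probability $$P_s=\sum_{f\in\mathcal G_0^\perp}(1-p)^{n-|f|}p^{|f|}=\frac1{|\mathcal G_0|}\sum_{f\in\mathcal G_0}(1-2p)^{|f|}>0$$ and, conditioned on success, outputs the $k$-qubit state $$\rho_{out}=\frac1{P_s}\sum_{x\in\mathbb F_2^k}p_{out}(x)\,|A_x\rangle\langle A_x|,\qquad p_{out}(x)=\sum_{f\in\mathcal G^\perp+x_1f^1+\cdots+x_kf^k}(1-p)^{n-|f|}p^{|f|},$$ where $|A_x\rangle=|A_{x_1}\rangle\otimes\cdots\otimes|A_{x_k}\rangle$. Moreover every syndrome $\mu$ in Step 1 occurs with probability $2^{-\dim\mathcal G^\perp}$, and conditionally on $\mu$ the success probability is again $P_s$ and the output state again $\rho_{out}$. The main subroutine has the same success probability $P_s$ and the same output state $\rho_{out}$. -/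

import Mathlib

open scoped Matrix

noncomputable section

namespace MagicDistillation

/-! ### Binary vectors, binary matrices and binary spaces -/

/-- Binary vectors of length `n`; they also label the computational basis of `n` qubits.
The weight `|f|` is `hammingNorm f` and the inner product `(f, g)` is `f ⬝ᵥ g`. -/
abbrev BinVec (n : ℕ) := Fin n → ZMod 2

/-- A binary matrix is triorthogonal if any pair and any triple of its rows have even overlap. -/
def IsTriorthogonal {m n : ℕ} (G : Matrix (Fin m) (Fin n) (ZMod 2)) : Prop :=
  (∀ a b : Fin m, a < b → ∑ j, G a j * G b j = 0) ∧
  (∀ a b c : Fin m, a < b → b < c → ∑ j, G a j * G b j * G c j = 0)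

/-- The space `𝒢` spanned by all rows of `G`. -/
def rowSpace {m n : ℕ} (G : Matrix (Fin m) (Fin n) (ZMod 2)) : Submodule (ZMod 2) (BinVec n) :=
  Submodule.span (ZMod 2) (Set.range fun i => G i)

/-- The space `𝒢₀` spanned by the even-weight rows of `G`. -/
def evenSpace {m n : ℕ} (G : Matrix (Fin m) (Fin n) (ZMod 2)) : Submodule (ZMod 2) (BinVec n) :=
  Submodule.span (ZMod 2) {f | ∃ i, f = G i ∧ Even (hammingNorm (G i))}

/-- The dual space `W^⊥`. -/
def dualSpace {n : ℕ} (W : Submodule (ZMod 2) (BinVec n)) : Submodule (ZMod 2) (BinVec n) where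
  carrier := {f | ∀ g ∈ W, f ⬝ᵥ g = 0}
  add_mem' := by
    intro a b ha hb g hg
    rw [add_dotProduct, ha g hg, hb g hg, add_zero]
  zero_mem' := by
    intro g _
    exact zero_dotProduct g
  smul_mem' := by
    intro c a ha g hg
    rw [smul_dotProduct, ha g hg, smul_zero]

/-- The row `f^a` among the first `k` rows of `G`. -/
def oddRow {m n k : ℕ} (G : Matrix (Fin m) (Fin n) (ZMod 2)) (hk : k ≤ m) (a : Fin k) :
    BinVec n :=
  G (Fin.castLE hk a)

/-- The `i`-th row of `G` after the first `k` rows. -/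
def evenRow {m n k : ℕ} (G : Matrix (Fin m) (Fin n) (ZMod 2)) (hk : k ≤ m) (i : Fin (m - k)) :
    BinVec n :=
  G ⟨k + i, by omega⟩

/-- The vector `x₁ f¹ + ⋯ + x_k f^k`. -/
def oddComb {m n k : ℕ} (G : Matrix (Fin m) (Fin n) (ZMod 2)) (hk : k ≤ m) (x : BinVec k) :
    BinVec n :=
  ∑ a, x a • oddRow G hk a

/-! ### Qubits, gates and Pauli operators -/

/-- One-qubit operators. -/
abbrev Gate := Matrix (ZMod 2) (ZMod 2) ℂ

/-- Operators on `n` qubits in the computational basis. -/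
abbrev QOp (n : ℕ) := Matrix (BinVec n) (BinVec n) ℂ

def gateX : Gate := Matrix.of fun u v => if u = v then 0 else 1
def gateZ : Gate := Matrix.diagonal fun u => if u = 0 then 1 else -1
def gateY : Gate := Complex.I • (gateX * gateZ)
/-- `S = diag(1, i)`. -/
def gateS : Gate := Matrix.diagonal fun u => if u = 0 then 1 else Complex.I
/-- The phase `e^{iπ/4}`. -/
def omega8 : ℂ := Complex.exp (Complex.I * Real.pi / 4)
/-- `T = diag(1, e^{iπ/4})`. -/
def gateT : Gate := Matrix.diagonal fun u => if u = 0 then 1 else omega8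
/-- `A = e^{-iπ/4} S X`. -/
def gateA : Gate := omega8⁻¹ • (gateS * gateX)

/-- The tensor product `O₁ ⊗ ⋯ ⊗ O_n`. -/
def tensorOp {n : ℕ} (O : Fin n → Gate) : QOp n :=
  Matrix.of fun u v => ∏ j, O j (u j) (v j)

/-- `O(f) = O^{f₁} ⊗ ⋯ ⊗ O^{f_n}`. -/
def pw {n : ℕ} (O : Gate) (f : BinVec n) : QOp n :=
  tensorOp fun j => O ^ (f j).val

/-- The `n`-qubit Pauli group: operators `i^ω P₁ ⊗ ⋯ ⊗ P_n` with `P_j ∈ {I, X, Y, Z}`. -/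
def pauliGroup (n : ℕ) : Set (QOp n) :=
  {P | ∃ (ω : ℕ) (Q : Fin n → Gate),
    (∀ j, Q j = 1 ∨ Q j = gateX ∨ Q j = gateY ∨ Q j = gateZ) ∧ P = Complex.I ^ ω • tensorOp Q}

/-- `V` belongs to the Clifford group: it is unitary and `V 𝒫_n V† = 𝒫_n`. -/
def IsClifford {n : ℕ} (V : QOp n) : Prop :=
  V ∈ Matrix.unitaryGroup (BinVec n) ℂ ∧ (fun P => V * P * Vᴴ) '' pauliGroup n = pauliGroup n

/-- The gate `S` acting on qubit `p`. -/
def sOn {n : ℕ} (p : Fin n) : QOp n := pw gateS (Pi.single p 1)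

/-- The controlled-`Z` gate acting on qubits `p` and `q`. -/
def czOn {n : ℕ} (p q : Fin n) : QOp n :=
  Matrix.diagonal fun u => if u p = 1 ∧ u q = 1 then -1 else 1

/-- Operators composed of `Λ(Z)` and `S` gates only. -/
def czsMonoid (n : ℕ) : Submonoid (QOp n) :=
  Submonoid.closure ({V | ∃ p, V = sOn p} ∪ {V | ∃ p q, p ≠ q ∧ V = czOn p q})

/-! ### States -/

/-- The operator `|ψ⟩⟨ψ|`. -/
def ketbra {α : Type} (ψ : α → ℂ) : Matrix α α ℂ := Matrix.vecMulVec ψ (star ψ)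

/-- The basis state `|u⟩`. -/
def ketBasis {n : ℕ} (u : BinVec n) : BinVec n → ℂ := Pi.single u 1

open Classical in
/-- The unnormalized state `∑_{g ∈ W} |g⟩`. -/
def ketSpace {n : ℕ} (W : Submodule (ZMod 2) (BinVec n)) : BinVec n → ℂ :=
  fun u => if u ∈ W then 1 else 0

/-- The one-qubit state `|+⟩`. -/
def ketPlus : ZMod 2 → ℂ := fun _ => ((Real.sqrt 2)⁻¹ : ℝ)

/-- The one-qubit states `|A₀⟩ = |A⟩ = T|+⟩` and `|A₁⟩ = Z|A⟩`. -/
def ketA (α : ZMod 2) : ZMod 2 → ℂ := gateZ ^ α.val *ᵥ (gateT *ᵥ ketPlus)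

/-- The state `|A_x⟩ = |A_{x₁}⟩ ⊗ ⋯ ⊗ |A_{x_k}⟩`. -/
def ketAx {k : ℕ} (x : BinVec k) : BinVec k → ℂ := fun u => ∏ a, ketA (x a) (u a)

/-- The raw ancilla `ρ = (1-p)|A₀⟩⟨A₀| + p|A₁⟩⟨A₁|`. -/
def rawAncilla (p : ℝ) : Gate :=
  ((1 - p : ℝ) : ℂ) • ketbra (ketA 0) + (p : ℂ) • ketbra (ketA 1)

/-- The input state `ρ^{⊗n}`. -/
def rawInput (n : ℕ) (p : ℝ) : QOp n := tensorOp fun _ => rawAncilla p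

/-- The unnormalized encoded state
`(I + e^{iπ/4} X(f¹)) ⋯ (I + e^{iπ/4} X(f^k)) |G₀⟩`. -/
def encodedA {m n k : ℕ} (G : Matrix (Fin m) (Fin n) (ZMod 2)) (hk : k ≤ m) : BinVec n → ℂ :=
  (List.ofFn fun a : Fin k => (1 : QOp n) + omega8 • pw gateX (oddRow G hk a)).prod *ᵥ
    ketSpace (evenSpace G)

/-- The (unnormalized) encoded basis state `X̄₁^{x₁} ⋯ X̄_k^{x_k} |G₀⟩` of the code
`CSS(X, 𝒢₀; Z, 𝒢^⊥)` with logical operators `X̄_a = X(f^a)`, `Z̄_a = Z(f^a)`. -/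
def encodedBasis {m n k : ℕ} (G : Matrix (Fin m) (Fin n) (ZMod 2)) (hk : k ≤ m) (x : BinVec k) :
    BinVec n → ℂ :=
  pw gateX (oddComb G hk x) *ᵥ ketSpace (evenSpace G)

/-- `U` is composed of `Λ(Z)` and `S` gates and `U T^{⊗n} |G⟩` is the encoded `|A^{⊗k}⟩`. -/
def IsPhaseCorrection {m n k : ℕ} (G : Matrix (Fin m) (Fin n) (ZMod 2)) (hk : k ≤ m)
    (U : QOp n) : Prop :=
  U ∈ czsMonoid n ∧
    U *ᵥ ((tensorOp fun _ => gateT) *ᵥ ketSpace (rowSpace G)) = encodedA G hk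

/-- The `n`-bit string that carries `x` on the positions `ι 0, …, ι (k-1)` and `0` elsewhere. -/
def padZero {n k : ℕ} (ι : Fin k ↪ Fin n) (x : BinVec k) : BinVec n :=
  Function.extend ι x 0

/-- `D` is a Clifford decoding unitary: it maps each normalized encoded basis state to
`|x⟩` on the output qubits `ι` and `|0⟩` on all other qubits. -/
def IsDecoder {m n k : ℕ} (G : Matrix (Fin m) (Fin n) (ZMod 2)) (hk : k ≤ m)
    (ι : Fin k ↪ Fin n) (D : QOp n) : Prop :=
  IsClifford D ∧ ∀ x : BinVec k,
    D *ᵥ (((Real.sqrt (Nat.card (evenSpace G)))⁻¹ : ℝ) • encodedBasis G hk x) =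
      ketBasis (padZero ι x)

open Classical in
/-- The partial trace over all qubits outside the range of `ι`. -/
def keepQubits {n k : ℕ} (ι : Fin k ↪ Fin n) (σ : QOp n) : QOp k :=
  Matrix.of fun x y => ∑ u : BinVec n, ∑ v : BinVec n,
    if (∀ a, u (ι a) = x a) ∧ (∀ a, v (ι a) = y a) ∧ (∀ j, j ∉ Set.range ι → u j = v j)
    then σ u v else 0

/-! ### Adaptive protocols on a fixed register of `n` qubits -/

/-- An adaptive protocol acting on `n` qubits (there are no further qubits): unitaries,
non-destructive measurements of `±1`-valued observables with classical control of what follows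
(outcome `μ` stands for the eigenvalue `(-1)^μ`), declaring failure, and returning `k` of the
`n` qubits. -/
inductive Protocol (n k : ℕ) : Type
  | failed : Protocol n k
  | output (ι : Fin k ↪ Fin n) : Protocol n k
  | unitary (V : QOp n) (next : Protocol n k) : Protocol n k
  | measure (P : QOp n) (next : ZMod 2 → Protocol n k) : Protocol n k

/-- The projector `(1 + (-1)^μ P) / 2`. -/
def eigProj {n : ℕ} (P : QOp n) (μ : ZMod 2) : QOp n :=
  (1 / 2 : ℂ) • (1 + (-1 : ℂ) ^ μ.val • P)

namespace Protocol

/-- The unnormalized final state on the non-failed branches; its trace is the probability not to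
fail. -/
def run {n k : ℕ} : Protocol n k → QOp n → QOp k
  | failed, _ => 0
  | output ι, σ => keepQubits ι σ
  | unitary V next, σ => next.run (V * σ * Vᴴ)
  | measure P next, σ => ∑ μ : ZMod 2, (next μ).run (eigProj P μ * σ * eigProj P μ)

/-- The success probability on the input state `σ`. -/
def successProb {n k : ℕ} (q : Protocol n k) (σ : QOp n) : ℂ := (q.run σ).trace

/-- The normalized output state, conditioned on success. -/
def outputState {n k : ℕ} (q : Protocol n k) (σ : QOp n) : QOp k :=
  (q.successProb σ)⁻¹ • q.run σ

/-- All unitaries are Clifford and all measured observables are Hermitian Pauli operators. -/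
def UsesOnlyClifford {n k : ℕ} : Protocol n k → Prop
  | failed => True
  | output _ => True
  | unitary V next => IsClifford V ∧ next.UsesOnlyClifford
  | measure P next => (P ∈ pauliGroup n ∧ P.IsHermitian) ∧ ∀ μ, (next μ).UsesOnlyClifford

/-- The (largest) number of measurements made in a run of the protocol. -/
def numMeasurements {n k : ℕ} : Protocol n k → ℕ
  | failed => 0
  | output _ => 0
  | unitary _ next => next.numMeasurements
  | measure _ next => 1 + max (next 0).numMeasurements (next 1).numMeasurements

/-- Measure `P 0, …, P (d-1)` one after the other and continue depending on the outcomes. -/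
def measureAll {n k : ℕ} :
    (d : ℕ) → (Fin d → QOp n) → (BinVec d → Protocol n k) → Protocol n k
  | 0, _, c => c ![]
  | d + 1, P, c => measure (P 0) fun μ =>
      measureAll d (fun i => P i.succ) fun ν => c (Fin.cons μ ν)

end Protocol

/-- Apply `U`; measure `X(g i)` for all `i` and fail unless all eigenvalues are `+1`;
apply the decoding unitary `D` and return the qubits `ι`. -/
def postselectAndDecode {n k r : ℕ} (U : QOp n) (g : Fin r → BinVec n) (D : QOp n)
    (ι : Fin k ↪ Fin n) : Protocol n k :=
  .unitary U <| .measureAll r (fun i => pw gateX (g i)) fun ν =>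
    if ν = 0 then .unitary D (.output ι) else .failed

/-! ### The two distillation subroutines -/

/-- The probability `(1-p)^{n-|f|} p^{|f|}` of the error pattern `f`. -/
def errProb {n : ℕ} (p : ℝ) (f : BinVec n) : ℝ :=
  (1 - p) ^ (n - hammingNorm f) * p ^ hammingNorm f

/-- The channel `ℰ^{⊗n}` with `ℰ(η) = (1-p) η + p Z η Z`. -/
def zNoise {n : ℕ} (p : ℝ) (η : QOp n) : QOp n :=
  ∑ f : BinVec n, (errProb p f : ℂ) • (pw gateZ f * η * pw gateZ f)

/-- The state `(ℰ ∘ 𝒯)^{⊗n}(|G⟩⟨G|)`, with `|G⟩` normalized, on which the main subroutine goes on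
to act: the encoded `|+^{⊗k}⟩` after `n` noisy `T`-gates. -/
def mainState {m n : ℕ} (G : Matrix (Fin m) (Fin n) (ZMod 2)) (p : ℝ) : QOp n :=
  zNoise p ((tensorOp fun _ => gateT) *
    ((Nat.card (rowSpace G) : ℂ)⁻¹ • ketbra (ketSpace (rowSpace G))) *
    (tensorOp fun _ => gateT)ᴴ)

/-- The part of the main subroutine that follows the noisy `T`-gates: apply `U`, measure `X(f)`
for all rows `f` of `G₀`, post-select and decode. -/
def mainProtocol {m n k : ℕ} (G : Matrix (Fin m) (Fin n) (ZMod 2)) (hk : k ≤ m)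
    (U D : QOp n) (ι : Fin k ↪ Fin n) : Protocol n k :=
  postselectAndDecode U (evenRow G hk) D ι

/-- The free choices made by the alternative subroutine: bases of `𝒢^⊥` and of `𝒢₀`, for every
`Z`-syndrome `μ` a vector `w μ` with this syndrome, the unitary `U` and a decoder. -/
structure AltChoices {m n k : ℕ} (G : Matrix (Fin m) (Fin n) (ZMod 2)) (hk : k ≤ m) where
  d : ℕ
  zBasis : Module.Basis (Fin d) (ZMod 2) (dualSpace (rowSpace G))
  r : ℕ
  xBasis : Module.Basis (Fin r) (ZMod 2) (evenSpace G)
  w : BinVec d → BinVec n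
  w_spec : ∀ μ i, w μ ⬝ᵥ (zBasis i : BinVec n) = μ i
  U : QOp n
  U_spec : IsPhaseCorrection G hk U
  ι : Fin k ↪ Fin n
  D : QOp n
  D_spec : IsDecoder G hk ι D

namespace AltChoices

variable {m n k : ℕ} {G : Matrix (Fin m) (Fin n) (ZMod 2)} {hk : k ≤ m}

/-- Everything after the measurement of the `Z`-syndrome `μ`: apply `A(w)†`, then `U`,
post-select on trivial `X`-syndrome, decode. -/
def afterSyndrome (C : AltChoices G hk) (μ : BinVec C.d) : Protocol n k :=
  .unitary (pw gateA (C.w μ))ᴴ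
    (postselectAndDecode C.U (fun i => (C.xBasis i : BinVec n)) C.D C.ι)

/-- The alternative subroutine. -/
def protocol (C : AltChoices G hk) : Protocol n k :=
  .measureAll C.d (fun i => pw gateZ (C.zBasis i : BinVec n)) C.afterSyndrome

/-- The projector onto the states with `Z`-syndrome `μ`. -/
def syndromeProj (C : AltChoices G hk) (μ : BinVec C.d) : QOp n :=
  (List.ofFn fun i => eigProj (pw gateZ (C.zBasis i : BinVec n)) (μ i)).prod

end AltChoices

open Classical in
/-- `P_s = ∑_{f ∈ 𝒢₀^⊥} (1-p)^{n-|f|} p^{|f|}`. -/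
def Ps {m n : ℕ} (G : Matrix (Fin m) (Fin n) (ZMod 2)) (p : ℝ) : ℝ :=
  ∑ f : BinVec n with f ∈ dualSpace (evenSpace G), errProb p f

open Classical in
/-- `p_out(x) = ∑_{f ∈ 𝒢^⊥ + x₁ f¹ + ⋯ + x_k f^k} (1-p)^{n-|f|} p^{|f|}`. -/
def pOut {m n k : ℕ} (G : Matrix (Fin m) (Fin n) (ZMod 2)) (hk : k ≤ m) (p : ℝ)
    (x : BinVec k) : ℝ :=
  ∑ f : BinVec n with f - oddComb G hk x ∈ dualSpace (rowSpace G), errProb p f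

/-- `ρ_out = P_s⁻¹ ∑_x p_out(x) |A_x⟩⟨A_x|`. -/
def rhoOut {m n k : ℕ} (G : Matrix (Fin m) (Fin n) (ZMod 2)) (hk : k ≤ m) (p : ℝ) : QOp k :=
  ((Ps G p)⁻¹ : ℂ) • ∑ x : BinVec k, (pOut G hk p x : ℂ) • ketbra (ketAx x)

end MagicDistillation

end

open MagicDistillation

namespace MagicDistillation

/-! ### Signs and phases -/

/-! Everything reduces to a classical mixture over Z-errors. The product of raw ancillas is the
mixture, with weights `errProb p f`, of the pure states Z(f) T^{⊗n} |+⟩^{⊗n} (`rawInput_eq`). A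
syndrome μ for 𝒢^⊥ cuts the uniform superposition down to the coset w + 𝒢, because (𝒢^⊥)^⊥ = 𝒢, and
this projection commutes with the diagonal operators T^{⊗n} and Z(f). Since A(w) = T^{⊗n} X(w)
T^{⊗n}†, applying A(w)† moves the coset back to 𝒢. Passing A(w) through Z(f) costs only the sign
(-1)^{(f,w)}, invisible in |ψ⟩⟨ψ|. Hence every syndrome leaves exactly 2^{-d} times the state of the
main subroutine, where d = dim 𝒢^⊥ (`AltChoices.correction_syndromeProj`), and both subroutines
continue identically.

For a fixed error f (`run_postselectAndDecode`), U is diagonal and turns the state into Z(f) times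
the encoded |A^{⊗k}⟩. The operators X(g), g ∈ 𝒢₀, have eigenvalue (-1)^{(f,g)} there, so f survives
iff f ∈ 𝒢₀^⊥. A surviving Z(f) acts as the logical Z-pattern x_a = (f, f^a) and decodes to |A_x⟩.
The odd rows are orthonormal and orthogonal to 𝒢₀, so the f with a given x form the coset 𝒢^⊥ + Σ
x_a f^a (`Triorthogonal.mem_dualSpace_evenSpace`); this gives p_out. The second formula for P_s is
the MacWilliams identity, and it is positive because 𝒢₀ has even weights.

The choices exist for two reasons. The phase that U must supply on 𝒢 has fourth-root values and, by
triorthogonality, a bilinear sign as its polar form, so it is a product of S and controlled-Z gates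
(`diagonal_mem_czsMonoid_of_quadratic`). A decoder is a linear change of basis followed by Hadamard
gates (`Triorthogonal.exists_isDecoder`). -/

theorem zmod_two_cases : ∀ t : ZMod 2, t = 0 ∨ t = 1 := by decide

/-- The sign `(-1)^t`. -/
noncomputable def sgn (t : ZMod 2) : ℂ := (-1) ^ t.val

@[simp] theorem sgn_zero : sgn 0 = 1 := by simp [sgn]

@[simp] theorem sgn_one : sgn 1 = -1 := by simp [sgn, ZMod.val_one]

theorem sgn_add (s t : ZMod 2) : sgn (s + t) = sgn s * sgn t := by
  rcases zmod_two_cases s with rfl | rfl <;> rcases zmod_two_cases t with rfl | rfl <;>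
    simp [show (1 + 1 : ZMod 2) = 0 from rfl]

theorem sgn_mul_self (t : ZMod 2) : sgn t * sgn t = 1 := by
  rcases zmod_two_cases t with rfl | rfl <;> simp

theorem sgn_sum {α : Type*} (s : Finset α) (f : α → ZMod 2) :
    sgn (∑ i ∈ s, f i) = ∏ i ∈ s, sgn (f i) := by
  classical
  induction s using Finset.induction_on with
  | empty => simp
  | insert a s ha ih => rw [Finset.sum_insert ha, Finset.prod_insert ha, sgn_add, ih]

@[simp] theorem star_sgn (t : ZMod 2) : star (sgn t) = sgn t := by
  rcases zmod_two_cases t with rfl | rfl <;> simp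

theorem sgn_natCast (a : ℕ) : sgn (a : ZMod 2) = (-1) ^ a := by
  rcases Nat.even_or_odd a with h | h
  · rw [(ZMod.natCast_eq_zero_iff_even).2 h, sgn_zero, h.neg_one_pow]
  · rw [(ZMod.natCast_eq_one_iff_odd).2 h, sgn_one, h.neg_one_pow]

theorem omega8_sq : omega8 ^ 2 = Complex.I := by
  rw [omega8, ← Complex.exp_nat_mul]
  rw [show ((2 : ℕ) : ℂ) * (Complex.I * Real.pi / 4) = (Real.pi / 2 : ℂ) * Complex.I by
    push_cast; ring]
  exact Complex.exp_pi_div_two_mul_I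

theorem omega8_ne_zero : omega8 ≠ 0 := Complex.exp_ne_zero _

theorem star_omega8 : star omega8 = omega8⁻¹ := by
  rw [omega8, ← Complex.exp_neg, Complex.star_def, ← Complex.exp_conj]
  congr 1
  simp only [map_div₀, map_mul, Complex.conj_I, Complex.conj_ofReal, map_ofNat]
  ring

theorem star_omega8_mul : star omega8 * omega8 = 1 := by
  rw [star_omega8, inv_mul_cancel₀ omega8_ne_zero]

/-! ### Binary vectors -/

variable {n k : ℕ}

theorem binVec_add_self (f : BinVec n) : f + f = 0 := by
  funext j
  exact CharTwo.add_self_eq_zero (f j)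

theorem binVec_sub (f g : BinVec n) : f - g = f + g := by
  funext j
  exact CharTwo.sub_eq_add (f j) (g j)

theorem eq_add_iff_add_eq (u v f : BinVec n) : u = v + f ↔ v = u + f := by
  constructor <;> rintro rfl <;> rw [add_assoc, binVec_add_self, add_zero]

theorem natCast_hammingNorm {α : Type*} [Fintype α] (f : α → ZMod 2) :
    (hammingNorm f : ZMod 2) = ∑ j, f j := by
  classical
  rw [hammingNorm, Finset.card_filter, Nat.cast_sum]
  refine Finset.sum_congr rfl fun j _ => ?_
  rcases zmod_two_cases (f j) with h | h <;> simp [h]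

theorem even_hammingNorm_iff (f : BinVec n) : Even (hammingNorm f) ↔ ∑ j, f j = 0 := by
  rw [← natCast_hammingNorm, ZMod.natCast_eq_zero_iff_even]

theorem pow_hammingNorm {α : Type*} [Fintype α] {M : Type*} [CommMonoid M] (z : M)
    (f : α → ZMod 2) : z ^ hammingNorm f = ∏ j, if f j = 0 then 1 else z := by
  classical
  rw [hammingNorm, Finset.prod_ite, Finset.prod_const_one, one_mul, Finset.prod_const]

theorem zmod_two_mul_self (t : ZMod 2) : t * t = t := by
  rcases zmod_two_cases t with rfl | rfl <;> rfl

/-! ### Tensor products of one-qubit operators -/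

theorem tensorOp_mul (O P : Fin n → Gate) :
    tensorOp O * tensorOp P = tensorOp fun j => O j * P j := by
  ext u v
  simp only [tensorOp, Matrix.mul_apply, Matrix.of_apply, Finset.prod_univ_sum,
    Fintype.piFinset_univ, Finset.prod_mul_distrib]

theorem tensorOp_conjTranspose (O : Fin n → Gate) :
    (tensorOp O)ᴴ = tensorOp fun j => (O j)ᴴ := by
  ext u v
  simp [tensorOp, Matrix.conjTranspose_apply]

theorem tensorOp_diagonal (d : Fin n → ZMod 2 → ℂ) :
    (tensorOp fun j => Matrix.diagonal (d j)) = Matrix.diagonal fun u => ∏ j, d j (u j) := by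
  ext u v
  simp only [tensorOp, Matrix.of_apply, Matrix.diagonal_apply, Finset.prod_ite_zero,
    Finset.mem_univ, true_imp_iff, funext_iff]

theorem tensorOp_one : (tensorOp fun _ => (1 : Gate)) = (1 : QOp n) := by
  have h := tensorOp_diagonal (n := n) fun _ _ => 1
  simpa using h

theorem tensorOp_smul (c : Fin n → ℂ) (O : Fin n → Gate) :
    (tensorOp fun j => c j • O j) = (∏ j, c j) • tensorOp O := by
  ext u v
  simp [tensorOp, Finset.prod_mul_distrib]

theorem tensorOp_mulVec (O : Fin n → Gate) (ψ : Fin n → ZMod 2 → ℂ) :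
    (tensorOp O *ᵥ fun u => ∏ j, ψ j (u j)) = fun u => ∏ j, (O j *ᵥ ψ j) (u j) := by
  ext u
  simp only [tensorOp, Matrix.mulVec, dotProduct, Matrix.of_apply, Finset.prod_univ_sum,
    Fintype.piFinset_univ, Finset.prod_mul_distrib]

theorem gateX_pow (t : ZMod 2) :
    gateX ^ t.val = Matrix.of fun u v => if u = v + t then 1 else 0 := by
  ext u v
  rcases zmod_two_cases t with rfl | rfl
  · simp [Matrix.one_apply]
  · rcases zmod_two_cases u with rfl | rfl <;> rcases zmod_two_cases v with rfl | rfl <;>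
      simp [gateX, ZMod.val_one, show (1 + 1 : ZMod 2) = 0 from rfl]

theorem gateZ_pow (t : ZMod 2) :
    gateZ ^ t.val = Matrix.diagonal fun u => sgn (t * u) := by
  rcases zmod_two_cases t with rfl | rfl
  · simp
  · rw [ZMod.val_one, pow_one, gateZ]
    congr 1
    funext u
    rcases zmod_two_cases u with rfl | rfl <;> simp

theorem gateS_pow (t : ZMod 2) :
    gateS ^ t.val = Matrix.diagonal fun u => if t * u = 0 then 1 else Complex.I := by
  rcases zmod_two_cases t with rfl | rfl
  · simp
  · simp [ZMod.val_one, gateS]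

theorem pw_gateX (f : BinVec n) :
    pw gateX f = Matrix.of fun u v => if u = v + f then 1 else 0 := by
  ext u v
  simp only [pw, tensorOp, gateX_pow, Matrix.of_apply, Fintype.prod_boole, funext_iff,
    Pi.add_apply]
  congr

theorem pw_gateZ (f : BinVec n) : pw gateZ f = Matrix.diagonal fun u => sgn (f ⬝ᵥ u) := by
  simp only [pw, gateZ_pow, tensorOp_diagonal, dotProduct, sgn_sum]

theorem tensorOp_gateT :
    (tensorOp fun _ => gateT) = (Matrix.diagonal fun u => omega8 ^ hammingNorm u : QOp n) := by
  simp only [gateT, tensorOp_diagonal, pow_hammingNorm]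

theorem pw_gateX_mulVec (f : BinVec n) (ψ : BinVec n → ℂ) (u : BinVec n) :
    (pw gateX f *ᵥ ψ) u = ψ (u + f) := by
  simp only [pw_gateX, Matrix.mulVec, dotProduct, Matrix.of_apply, ite_mul, one_mul, zero_mul,
    eq_add_iff_add_eq u, Finset.sum_ite_eq', Finset.mem_univ, if_true]

theorem pw_gateZ_mulVec (f : BinVec n) (ψ : BinVec n → ℂ) (u : BinVec n) :
    (pw gateZ f *ᵥ ψ) u = sgn (f ⬝ᵥ u) * ψ u := by
  rw [pw_gateZ, Matrix.mulVec_diagonal]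

theorem pw_gateX_mul (f g : BinVec n) : pw gateX f * pw gateX g = pw gateX (f + g) := by
  apply Matrix.mulVec_injective
  funext ψ
  funext u
  rw [← Matrix.mulVec_mulVec]
  simp only [pw_gateX_mulVec, add_assoc]

theorem pw_gateZ_mul (f g : BinVec n) : pw gateZ f * pw gateZ g = pw gateZ (f + g) := by
  simp only [pw_gateZ, Matrix.diagonal_mul_diagonal, add_dotProduct, sgn_add]

theorem pw_zero (O : Gate) : pw O (0 : BinVec n) = 1 := by
  simp [pw, tensorOp_one]

theorem pw_gateZ_isHermitian (f : BinVec n) : (pw gateZ f).IsHermitian := by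
  rw [pw_gateZ]
  apply Matrix.isHermitian_diagonal_of_self_adjoint
  ext u
  simp

theorem pw_gateX_isHermitian (f : BinVec n) : (pw gateX f).IsHermitian := by
  ext u v
  simp only [Matrix.conjTranspose_apply, pw_gateX, Matrix.of_apply, apply_ite star, star_one,
    star_zero, eq_add_iff_add_eq u]

/-- X and Z anticommute on each qubit where both act, so the sign is the parity of the overlap. -/
theorem pw_gateZ_mul_pw_gateX (f g : BinVec n) :
    pw gateZ f * pw gateX g = sgn (f ⬝ᵥ g) • (pw gateX g * pw gateZ f) := by
  apply Matrix.mulVec_injective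
  funext ψ
  funext u
  rw [Matrix.smul_mulVec, ← Matrix.mulVec_mulVec, ← Matrix.mulVec_mulVec]
  simp only [pw_gateX_mulVec, pw_gateZ_mulVec, Pi.smul_apply, dotProduct_add, sgn_add, smul_eq_mul]
  linear_combination -(sgn (f ⬝ᵥ u) * ψ (u + g)) * sgn_mul_self (f ⬝ᵥ g)

/-! ### The gate `A` -/

theorem gateT_mul_conjTranspose : gateT * gateTᴴ = 1 := by
  rw [gateT, Matrix.diagonal_conjTranspose, Matrix.diagonal_mul_diagonal, ← Matrix.diagonal_one]
  congr 1
  funext u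
  have h := star_omega8_mul
  rw [mul_comm] at h
  by_cases hu : u = 0 <;> simp_all

theorem gateT_conjTranspose_mul : gateTᴴ * gateT = 1 :=
  mul_eq_one_comm.1 gateT_mul_conjTranspose

/-- This conjugate form is why A(w) shifts bit strings underneath the layer of T-gates. -/
theorem gateA_eq : gateA = gateT * gateX * gateTᴴ := by
  have h := star_omega8
  have h2 := omega8_sq
  have h0 := omega8_ne_zero
  simp only [Complex.star_def] at h
  ext u v
  rcases zmod_two_cases u with rfl | rfl <;> rcases zmod_two_cases v with rfl | rfl <;>
    simp [gateA, gateT, gateX, gateS, Matrix.diagonal_conjTranspose, Matrix.mul_diagonal,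
      Matrix.diagonal_mul, h]
  rw [← h2]
  field_simp

theorem gateA_pow (t : ZMod 2) : gateA ^ t.val = gateT * gateX ^ t.val * gateTᴴ := by
  rcases zmod_two_cases t with rfl | rfl
  · simp [gateT_mul_conjTranspose]
  · simp [ZMod.val_one, gateA_eq]

theorem pw_gateA (w : BinVec n) :
    pw gateA w = (tensorOp fun _ => gateT) * pw gateX w * (tensorOp fun _ => gateT)ᴴ := by
  simp only [pw, gateA_pow, tensorOp_conjTranspose, tensorOp_mul]

theorem tensorOp_gateT_conjTranspose_mul :
    (tensorOp fun _ => gateT)ᴴ * (tensorOp fun _ => gateT) = (1 : QOp n) := by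
  simp only [tensorOp_conjTranspose, tensorOp_mul, gateT_conjTranspose_mul, tensorOp_one]

theorem tensorOp_gateT_mul_conjTranspose :
    (tensorOp fun _ => gateT) * (tensorOp fun _ => gateT)ᴴ = (1 : QOp n) :=
  mul_eq_one_comm.1 tensorOp_gateT_conjTranspose_mul

theorem pw_gateA_isHermitian (w : BinVec n) : (pw gateA w).IsHermitian := by
  rw [pw_gateA]
  exact Matrix.isHermitian_mul_mul_conjTranspose _ (pw_gateX_isHermitian w)

theorem pw_gateA_mul_tensorOp_gateT (w : BinVec n) :
    pw gateA w * (tensorOp fun _ => gateT) = (tensorOp fun _ => gateT) * pw gateX w := by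
  rw [pw_gateA, Matrix.mul_assoc, tensorOp_gateT_conjTranspose_mul, Matrix.mul_one]

/-- Operators `Z(f)` commute with `A(w)` up to a sign. -/
theorem pw_gateA_mul_pw_gateZ (w f : BinVec n) :
    pw gateA w * pw gateZ f = sgn (f ⬝ᵥ w) • (pw gateZ f * pw gateA w) := by
  have hT : ∀ D : BinVec n → ℂ, Commute (pw gateZ f) (Matrix.diagonal D) := fun D => by
    rw [pw_gateZ]
    exact Matrix.commute_diagonal _ _
  have h1 : Commute (pw gateZ f) (tensorOp fun _ => gateT) := by
    rw [tensorOp_gateT]; exact hT _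
  have h2 : Commute (pw gateZ f) (tensorOp fun _ => gateT)ᴴ := by
    rw [tensorOp_gateT, Matrix.diagonal_conjTranspose]; exact hT _
  have h3 : pw gateX w * pw gateZ f = sgn (f ⬝ᵥ w) • (pw gateZ f * pw gateX w) := by
    rw [pw_gateZ_mul_pw_gateX, smul_smul, sgn_mul_self, one_smul]
  rw [pw_gateA, Matrix.mul_assoc, ← h2.eq, ← Matrix.mul_assoc, Matrix.mul_assoc _ _ (pw gateZ f),
    h3, Matrix.mul_smul, Matrix.smul_mul, ← Matrix.mul_assoc, ← h1.eq]
  simp only [Matrix.mul_assoc]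

end MagicDistillation

namespace MagicDistillation

variable {n k m : ℕ}

/-! ### Binary linear algebra -/

theorem mem_dualSpace {W : Submodule (ZMod 2) (BinVec n)} {f : BinVec n} :
    f ∈ dualSpace W ↔ ∀ g ∈ W, f ⬝ᵥ g = 0 := Iff.rfl

theorem mem_dualSpace_span {s : Set (BinVec n)} {f : BinVec n} :
    f ∈ dualSpace (Submodule.span (ZMod 2) s) ↔ ∀ g ∈ s, f ⬝ᵥ g = 0 := by
  refine ⟨fun h g hg => h g (Submodule.subset_span hg), fun h g hg => ?_⟩
  induction hg using Submodule.span_induction with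
  | mem x hx => exact h x hx
  | zero => exact dotProduct_zero f
  | add x y _ _ hx hy => rw [dotProduct_add, hx, hy, add_zero]
  | smul c x _ hx => rw [dotProduct_smul, hx, smul_zero]

/-- The inner product as a bilinear form. -/
def dotForm (n : ℕ) : LinearMap.BilinForm (ZMod 2) (BinVec n) :=
  (dotProductEquiv (ZMod 2) (Fin n)).toLinearMap

theorem dotForm_apply (f g : BinVec n) : dotForm n f g = f ⬝ᵥ g := rfl

theorem dotForm_isSymm (f g : BinVec n) : dotForm n f g = dotForm n g f := dotProduct_comm f g

theorem dotForm_isRefl : (dotForm n).IsRefl := fun f g h => by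
  rwa [dotForm_isSymm]

theorem dotForm_nondegenerate : (dotForm n).Nondegenerate :=
  ⟨fun f h => dotProduct_eq_zero f h,
    fun f h => dotProduct_eq_zero f fun g => by rw [dotProduct_comm]; exact h g⟩

theorem dualSpace_eq_orthogonal (W : Submodule (ZMod 2) (BinVec n)) :
    dualSpace W = (dotForm n).orthogonal W := by
  ext f
  simp only [mem_dualSpace, LinearMap.BilinForm.mem_orthogonal_iff,
    dotForm_apply, dotProduct_comm f]

theorem dualSpace_dualSpace (W : Submodule (ZMod 2) (BinVec n)) :
    dualSpace (dualSpace W) = W := by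
  simp only [dualSpace_eq_orthogonal]
  exact LinearMap.BilinForm.orthogonal_orthogonal dotForm_nondegenerate dotForm_isRefl W

theorem finrank_dualSpace (W : Submodule (ZMod 2) (BinVec n)) :
    Module.finrank (ZMod 2) (dualSpace W) + Module.finrank (ZMod 2) W = n := by
  have h := LinearMap.BilinForm.finrank_orthogonal (dotForm_nondegenerate (n := n)) W
  have h2 := Submodule.finrank_le W
  rw [dualSpace_eq_orthogonal]
  simp only [Module.finrank_fin_fun] at h h2
  omega

theorem natCard_submodule (W : Submodule (ZMod 2) (BinVec n)) :
    Nat.card W = 2 ^ Module.finrank (ZMod 2) W := by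
  rw [Module.natCard_eq_pow_finrank (K := ZMod 2), Nat.card_zmod]

theorem exists_dotProduct_eq (φ : Module.Dual (ZMod 2) (BinVec n)) :
    ∃ w : BinVec n, ∀ f, w ⬝ᵥ f = φ f :=
  ⟨(dotProductEquiv (ZMod 2) (Fin n)).symm φ, fun f => by
    have h := (dotProductEquiv (ZMod 2) (Fin n)).apply_symm_apply φ
    exact congrArg (fun ψ : Module.Dual (ZMod 2) (BinVec n) => ψ f) h⟩

/-- Every syndrome of a linearly independent family of parity checks occurs. -/
theorem exists_syndrome {d : ℕ} {W : Submodule (ZMod 2) (BinVec n)}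
    (b : Module.Basis (Fin d) (ZMod 2) W) (μ : BinVec d) :
    ∃ w : BinVec n, ∀ i, w ⬝ᵥ (b i : BinVec n) = μ i := by
  -- The functional on `W` with prescribed values on the basis extends to the whole space, where the
  -- inner product represents it.
  obtain ⟨φ, hφ⟩ := LinearMap.exists_extend (b.constr (ZMod 2) μ)
  obtain ⟨w, hw⟩ := exists_dotProduct_eq φ
  refine ⟨w, fun i => ?_⟩
  rw [hw, ← b.constr_basis (ZMod 2) μ i, ← hφ]
  rfl

theorem basis_span {d : ℕ} {W : Submodule (ZMod 2) (BinVec n)}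
    (b : Module.Basis (Fin d) (ZMod 2) W) :
    Submodule.span (ZMod 2) (Set.range fun i => (b i : BinVec n)) = W := by
  have h := congrArg (Submodule.map W.subtype) b.span_eq
  rw [Submodule.map_span, Submodule.map_top, Submodule.range_subtype, ← Set.range_comp] at h
  exact h

/-! ### Triorthogonal matrices -/

/-- A triorthogonal matrix whose odd rows are the first `k` rows. -/
structure Triorthogonal (G : Matrix (Fin m) (Fin n) (ZMod 2)) (hk : k ≤ m) : Prop where
  tri : IsTriorthogonal G
  odd : ∀ i : Fin m, Odd (hammingNorm (G i)) ↔ (i : ℕ) < k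

variable {G : Matrix (Fin m) (Fin n) (ZMod 2)} {hk : k ≤ m}

theorem evenSpace_le_rowSpace : evenSpace G ≤ rowSpace G := by
  refine Submodule.span_mono ?_
  rintro f ⟨i, rfl, -⟩
  exact ⟨i, rfl⟩

theorem oddRow_mem (a : Fin k) : oddRow G hk a ∈ rowSpace G :=
  Submodule.subset_span ⟨_, rfl⟩

theorem oddComb_mem (x : BinVec k) : oddComb G hk x ∈ rowSpace G :=
  Submodule.sum_mem _ fun a _ => Submodule.smul_mem _ _ (oddRow_mem a)

theorem oddComb_add (x y : BinVec k) : oddComb G hk (x + y) = oddComb G hk x + oddComb G hk y := by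
  simp only [oddComb, Pi.add_apply, add_smul, Finset.sum_add_distrib]

/-- The overlaps of a vector with the odd rows. -/
def oddSyndrome (G : Matrix (Fin m) (Fin n) (ZMod 2)) (hk : k ≤ m) (f : BinVec n) : BinVec k :=
  fun a => f ⬝ᵥ oddRow G hk a

theorem oddSyndrome_add (f g : BinVec n) :
    oddSyndrome G hk (f + g) = oddSyndrome G hk f + oddSyndrome G hk g := by
  funext a
  exact add_dotProduct _ _ _

@[simp] theorem oddSyndrome_zero : oddSyndrome G hk 0 = 0 :=
  funext fun _ => zero_dotProduct _

@[simp] theorem oddComb_zero : oddComb G hk 0 = 0 := by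
  simp [oddComb]

theorem dotProduct_oddComb (f : BinVec n) (x : BinVec k) :
    f ⬝ᵥ oddComb G hk x = oddSyndrome G hk f ⬝ᵥ x := by
  rw [oddComb, dotProduct_sum, dotProduct]
  refine Finset.sum_congr rfl fun a _ => ?_
  rw [dotProduct_smul, smul_eq_mul, mul_comm]
  rfl

namespace Triorthogonal

/-- Off the diagonal this is pairwise triorthogonality; on it, t² = t turns the inner product into
the parity of the weight. Thus the odd rows are orthonormal and the even rows are orthogonal to
every row. -/
theorem row_dotProduct_row (h : Triorthogonal G hk) (i j : Fin m) :
    G i ⬝ᵥ G j = if i = j ∧ (i : ℕ) < k then 1 else 0 := by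
  rcases lt_trichotomy i j with hij | rfl | hij
  · rw [if_neg (by rintro ⟨rfl, -⟩; exact lt_irrefl _ hij)]
    exact h.tri.1 i j hij
  · simp only [dotProduct, zmod_two_mul_self, true_and]
    rw [← natCast_hammingNorm]
    split_ifs with hi
    · exact (ZMod.natCast_eq_one_iff_odd).2 ((h.odd i).2 hi)
    · exact (ZMod.natCast_eq_zero_iff_even).2 (Nat.not_odd_iff_even.1 fun ho => hi ((h.odd i).1 ho))
  · rw [if_neg (by rintro ⟨rfl, -⟩; exact lt_irrefl _ hij), dotProduct_comm]
    exact h.tri.1 j i hij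

theorem even_iff (h : Triorthogonal G hk) (i : Fin m) :
    Even (hammingNorm (G i)) ↔ ¬ (i : ℕ) < k := by
  rw [← h.odd i, Nat.not_odd_iff_even]

theorem oddRow_dotProduct_oddRow (h : Triorthogonal G hk) (a b : Fin k) :
    oddRow G hk a ⬝ᵥ oddRow G hk b = if a = b then 1 else 0 := by
  rw [oddRow, oddRow, h.row_dotProduct_row]
  simp

theorem evenSpace_eq_span (h : Triorthogonal G hk) :
    evenSpace G = Submodule.span (ZMod 2) (Set.range (evenRow G hk)) := by
  rw [evenSpace]
  congr 1
  ext f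
  constructor
  · rintro ⟨i, rfl, hi⟩
    have hik := (h.even_iff i).1 hi
    refine ⟨⟨i - k, by omega⟩, ?_⟩
    simp only [evenRow]
    congr 1
    ext
    simp only
    omega
  · rintro ⟨i, rfl⟩
    exact ⟨_, rfl, (h.even_iff _).2 (by simp)⟩

theorem evenSpace_le_dualSpace_rowSpace (h : Triorthogonal G hk) :
    evenSpace G ≤ dualSpace (rowSpace G) := by
  rw [evenSpace, Submodule.span_le]
  rintro f ⟨i, rfl, hi⟩
  rw [SetLike.mem_coe, rowSpace, mem_dualSpace_span]
  rintro _ ⟨j, rfl⟩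
  rw [h.row_dotProduct_row, if_neg fun hij => (h.even_iff i).1 hi hij.2]

theorem even_hammingNorm_of_mem (h : Triorthogonal G hk) {f : BinVec n} (hf : f ∈ evenSpace G) :
    Even (hammingNorm f) := by
  have := h.evenSpace_le_dualSpace_rowSpace hf f (evenSpace_le_rowSpace hf)
  simp only [dotProduct, zmod_two_mul_self] at this
  rwa [even_hammingNorm_iff]

theorem oddSyndrome_of_mem_evenSpace (h : Triorthogonal G hk) {f : BinVec n}
    (hf : f ∈ evenSpace G) : oddSyndrome G hk f = 0 :=
  funext fun a => h.evenSpace_le_dualSpace_rowSpace hf _ (oddRow_mem a)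

theorem oddSyndrome_oddComb (h : Triorthogonal G hk) (x : BinVec k) :
    oddSyndrome G hk (oddComb G hk x) = x := by
  funext a
  rw [oddSyndrome, dotProduct_comm, dotProduct_oddComb]
  simp only [oddSyndrome, dotProduct]
  change ∑ b, (oddRow G hk a ⬝ᵥ oddRow G hk b) * x b = x a
  simp [h.oddRow_dotProduct_oddRow]

/-- Every element of the row space splits into an odd and an even part. -/
theorem add_oddComb_mem_evenSpace (h : Triorthogonal G hk) {f : BinVec n} (hf : f ∈ rowSpace G) :
    f + oddComb G hk (oddSyndrome G hk f) ∈ evenSpace G := by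
  induction hf using Submodule.span_induction with
  | mem x hx =>
    obtain ⟨i, rfl⟩ := hx
    by_cases hi : (i : ℕ) < k
    · have h1 : G i = oddComb G hk (Pi.single ⟨i, hi⟩ 1) := by
        simp [oddComb, Pi.single_apply, oddRow]
      simp only
      rw [h1, h.oddSyndrome_oddComb, binVec_add_self]
      exact zero_mem _
    · have h1 : G i ∈ evenSpace G := Submodule.subset_span ⟨i, rfl, (h.even_iff i).2 hi⟩
      simp only
      rw [h.oddSyndrome_of_mem_evenSpace h1]
      simpa using h1
  | zero => simp
  | add x y _ _ hx hy =>
    rw [oddSyndrome_add, oddComb_add, add_add_add_comm]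
    exact add_mem hx hy
  | smul c x _ hx =>
    rcases zmod_two_cases c with rfl | rfl
    · simp
    · rwa [one_smul]

/-- Identifies the one encoded basis state in which a given string of 𝒢 occurs. -/
theorem mem_evenSpace_iff (h : Triorthogonal G hk) {f : BinVec n} (x : BinVec k) :
    f + oddComb G hk x ∈ evenSpace G ↔ f ∈ rowSpace G ∧ oddSyndrome G hk f = x := by
  constructor
  · intro hf
    have h1 : f = (f + oddComb G hk x) + oddComb G hk x := by
      rw [add_assoc, binVec_add_self, add_zero]
    have h2 : oddSyndrome G hk f = x := by
      rw [h1, oddSyndrome_add, h.oddSyndrome_of_mem_evenSpace hf, h.oddSyndrome_oddComb, zero_add]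
    refine ⟨?_, h2⟩
    rw [h1]
    exact add_mem (evenSpace_le_rowSpace hf) (oddComb_mem x)
  · rintro ⟨hf, rfl⟩
    exact h.add_oddComb_mem_evenSpace hf

/-- Errors that pass the X-checks are sorted by their overlaps with the odd rows, and each class is
a coset of 𝒢^⊥. In the converse direction, `g` is split into an even part and a combination of odd
rows. -/
theorem mem_dualSpace_evenSpace (h : Triorthogonal G hk) {f : BinVec n} (x : BinVec k) :
    f - oddComb G hk x ∈ dualSpace (rowSpace G) ↔
      f ∈ dualSpace (evenSpace G) ∧ oddSyndrome G hk f = x := by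
  rw [binVec_sub]
  constructor
  · intro hf
    constructor
    · intro g hg
      have h1 := hf g (evenSpace_le_rowSpace hg)
      have h2 := h.evenSpace_le_dualSpace_rowSpace hg _ (oddComb_mem (hk := hk) x)
      rw [dotProduct_comm] at h2
      rwa [add_dotProduct, h2, add_zero] at h1
    · have h1 : oddSyndrome G hk (f + oddComb G hk x) = 0 := funext fun a => hf _ (oddRow_mem a)
      rw [oddSyndrome_add, h.oddSyndrome_oddComb] at h1
      have h3 := congrArg (· + x) h1
      simpa [add_assoc, binVec_add_self] using h3
  · rintro ⟨hf, rfl⟩ g hg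
    set x := oddSyndrome G hk f
    have h1 := h.add_oddComb_mem_evenSpace hg
    set y := oddSyndrome G hk g
    have h2 : g = (g + oddComb G hk y) + oddComb G hk y := by
      rw [add_assoc, binVec_add_self, add_zero]
    have h3 := h.evenSpace_le_dualSpace_rowSpace h1 _ (oddComb_mem (hk := hk) x)
    rw [dotProduct_comm] at h3
    rw [h2, dotProduct_add, dotProduct_oddComb, oddSyndrome_add, h.oddSyndrome_oddComb,
      binVec_add_self, zero_dotProduct, add_zero, add_dotProduct, hf _ h1, h3, add_zero]

/-- The row space is the direct sum of the even space and the span of the odd rows. -/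
noncomputable def rowSpaceEquiv (h : Triorthogonal G hk) :
    rowSpace G ≃ₗ[ZMod 2] BinVec k × evenSpace G where
  toFun f := (oddSyndrome G hk f, ⟨f + oddComb G hk (oddSyndrome G hk f),
    h.add_oddComb_mem_evenSpace f.2⟩)
  invFun p := ⟨p.2 + oddComb G hk p.1,
    add_mem (evenSpace_le_rowSpace p.2.2) (oddComb_mem p.1)⟩
  map_add' f g := by
    ext1
    · exact oddSyndrome_add _ _
    · ext1
      simp only [Submodule.coe_add, Prod.snd_add, oddSyndrome_add, oddComb_add]
      abel
  map_smul' c f := by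
    rcases zmod_two_cases c with rfl | rfl
    · ext1
      · simp
      · ext1
        simp
    · simp
  left_inv f := by
    ext1
    simp only [add_assoc, binVec_add_self, add_zero]
  right_inv p := by
    ext1
    · simp only
      rw [oddSyndrome_add, h.oddSyndrome_of_mem_evenSpace p.2.2, h.oddSyndrome_oddComb, zero_add]
    · ext1
      simp only
      rw [oddSyndrome_add, h.oddSyndrome_of_mem_evenSpace p.2.2, h.oddSyndrome_oddComb, zero_add,
        add_assoc, binVec_add_self, add_zero]

theorem finrank_rowSpace (h : Triorthogonal G hk) :
    Module.finrank (ZMod 2) (rowSpace G) = k + Module.finrank (ZMod 2) (evenSpace G) := by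
  rw [h.rowSpaceEquiv.finrank_eq, Module.finrank_prod, Module.finrank_fin_fun]

theorem natCard_rowSpace (h : Triorthogonal G hk) :
    Nat.card (rowSpace G) = 2 ^ k * Nat.card (evenSpace G) := by
  rw [natCard_submodule, natCard_submodule, h.finrank_rowSpace, pow_add]

end Triorthogonal

end MagicDistillation

namespace MagicDistillation

variable {n k : ℕ}

/-! ### Pure states -/

theorem ketbra_apply {α : Type} (ψ : α → ℂ) (u v : α) : ketbra ψ u v = ψ u * star (ψ v) := rfl

theorem mul_ketbra_mul {α : Type} [Fintype α] (V : Matrix α α ℂ) (ψ : α → ℂ) :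
    V * ketbra ψ * Vᴴ = ketbra (V *ᵥ ψ) := by
  rw [ketbra, ketbra, Matrix.mul_vecMulVec, Matrix.vecMulVec_mul, Matrix.star_mulVec]

theorem ketbra_smul {α : Type} (c : ℂ) (ψ : α → ℂ) : ketbra (c • ψ) = (c * star c) • ketbra ψ := by
  ext u v
  simp only [ketbra_apply, Pi.smul_apply, smul_eq_mul, star_mul', Matrix.smul_apply]
  ring

theorem ketbra_sgn_smul {α : Type} (t : ZMod 2) (ψ : α → ℂ) : ketbra (sgn t • ψ) = ketbra ψ := by
  rw [ketbra_smul, star_sgn, sgn_mul_self, one_smul]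

@[simp] theorem ketbra_zero {α : Type} : ketbra (0 : α → ℂ) = 0 := by
  ext u v
  simp [ketbra_apply]

/-! ### Linearity of protocols -/

theorem keepQubits_add (ι : Fin k ↪ Fin n) (σ τ : QOp n) :
    keepQubits ι (σ + τ) = keepQubits ι σ + keepQubits ι τ := by
  ext x y
  simp only [keepQubits, Matrix.of_apply, Matrix.add_apply, ← Finset.sum_add_distrib]
  refine Finset.sum_congr rfl fun u _ => Finset.sum_congr rfl fun v _ => ?_
  split_ifs <;> simp

theorem keepQubits_smul (ι : Fin k ↪ Fin n) (c : ℂ) (σ : QOp n) :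
    keepQubits ι (c • σ) = c • keepQubits ι σ := by
  ext x y
  simp only [keepQubits, Matrix.of_apply, Matrix.smul_apply, Finset.smul_sum]
  refine Finset.sum_congr rfl fun u _ => Finset.sum_congr rfl fun v _ => ?_
  split_ifs <;> simp

namespace Protocol

/-- Keeping `run` unnormalized makes it linear, so a mixed input can be followed one pure state at a
time. -/
theorem run_add (q : Protocol n k) (σ τ : QOp n) : q.run (σ + τ) = q.run σ + q.run τ := by
  induction q generalizing σ τ with
  | failed => simp [run]
  | output ι => exact keepQubits_add ι σ τ
  | unitary V next ih => simp only [run, Matrix.mul_add, Matrix.add_mul, ih]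
  | measure P next ih =>
    simp only [run, Matrix.mul_add, Matrix.add_mul, ih, Finset.sum_add_distrib]

theorem run_smul (q : Protocol n k) (c : ℂ) (σ : QOp n) : q.run (c • σ) = c • q.run σ := by
  induction q generalizing σ with
  | failed => simp [run]
  | output ι => exact keepQubits_smul ι c σ
  | unitary V next ih => simp only [run, Matrix.mul_smul, Matrix.smul_mul, ih]
  | measure P next ih => simp only [run, Matrix.mul_smul, Matrix.smul_mul, ih, Finset.smul_sum]

/-- A protocol as a linear map. -/
noncomputable def runLinear (q : Protocol n k) : QOp n →ₗ[ℂ] QOp k where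
  toFun := q.run
  map_add' := q.run_add
  map_smul' := q.run_smul

theorem run_sum {α : Type*} (s : Finset α) (q : Protocol n k) (σ : α → QOp n) :
    q.run (∑ i ∈ s, σ i) = ∑ i ∈ s, q.run (σ i) :=
  map_sum q.runLinear σ s

@[simp] theorem run_zero (q : Protocol n k) : q.run 0 = 0 := map_zero q.runLinear

/-! ### Sequences of measurements -/

theorem numMeasurements_measureAll (N : ℕ) (d : ℕ) (P : Fin d → QOp n)
    (c : BinVec d → Protocol n k) (hc : ∀ ν, (c ν).numMeasurements = N) :
    (measureAll d P c).numMeasurements = d + N := by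
  induction d with
  | zero => simp [measureAll, hc]
  | succ d ih =>
    simp only [measureAll, numMeasurements]
    rw [ih _ _ fun ν => hc _, ih _ _ fun ν => hc _, max_self]
    omega

theorem usesOnlyClifford_measureAll (d : ℕ) (P : Fin d → QOp n) (c : BinVec d → Protocol n k)
    (hP : ∀ i, P i ∈ pauliGroup n ∧ (P i).IsHermitian) (hc : ∀ ν, (c ν).UsesOnlyClifford) :
    (measureAll d P c).UsesOnlyClifford := by
  induction d with
  | zero => exact hc _
  | succ d ih => exact ⟨hP 0, fun μ => ih _ _ (fun i => hP _) fun ν => hc _⟩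

end Protocol

theorem eigProj_isHermitian {P : QOp n} (hP : P.IsHermitian) (μ : ZMod 2) :
    (eigProj P μ)ᴴ = eigProj P μ := by
  simp [eigProj, hP.eq]

theorem eigProj_mulVec {P : QOp n} {ψ : BinVec n → ℂ} {s : ZMod 2} (hψ : P *ᵥ ψ = sgn s • ψ)
    (μ : ZMod 2) : eigProj P μ *ᵥ ψ = if μ = s then ψ else 0 := by
  rw [eigProj, Matrix.smul_mulVec, Matrix.add_mulVec, Matrix.smul_mulVec, hψ, Matrix.one_mulVec,
    smul_smul, show ((-1 : ℂ) ^ μ.val) = sgn μ from rfl, ← sgn_add]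
  split_ifs with h
  · rw [h, CharTwo.add_self_eq_zero, sgn_zero, one_smul, ← two_smul ℂ, smul_smul]
    norm_num
  · have h1 : μ + s = 1 := by
      rcases zmod_two_cases μ with rfl | rfl <;> rcases zmod_two_cases s with rfl | rfl <;>
        first | rfl | exact absurd rfl h
    rw [h1, sgn_one, neg_smul, one_smul, add_neg_cancel, smul_zero]

/-- Measuring observables on a joint eigenvector yields the eigenvalues with certainty. -/
theorem run_measureAll_of_eigenvector (d : ℕ) (P : Fin d → QOp n) (hP : ∀ i, (P i).IsHermitian)
    (c : BinVec d → Protocol n k) {ψ : BinVec n → ℂ} {s : BinVec d}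
    (hψ : ∀ i, P i *ᵥ ψ = sgn (s i) • ψ) :
    (Protocol.measureAll d P c).run (ketbra ψ) = (c s).run (ketbra ψ) := by
  induction d with
  | zero =>
    rw [Protocol.measureAll, Subsingleton.elim s ![]]
  | succ d ih =>
    simp only [Protocol.measureAll, Protocol.run]
    have h1 : ∀ μ, eigProj (P 0) μ * ketbra ψ * eigProj (P 0) μ =
        if μ = s 0 then ketbra ψ else 0 := by
      intro μ
      have h2 := mul_ketbra_mul (eigProj (P 0) μ) ψ
      rw [eigProj_isHermitian (hP 0)] at h2
      rw [h2, eigProj_mulVec (hψ 0)]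
      split_ifs <;> simp
    rw [Finset.sum_eq_single (s 0)]
    · rw [h1, if_pos rfl, ih (fun i => P i.succ) (fun i => hP _) _ (s := Fin.tail s)
        fun i => hψ _, Fin.cons_self_tail]
    · intro μ _ hμ
      rw [h1, if_neg hμ, Protocol.run_zero]
    · simp

theorem eigProj_diagonal_sgn (f : BinVec n) (μ : ZMod 2) :
    eigProj (pw gateZ f) μ = Matrix.diagonal fun u => if f ⬝ᵥ u = μ then 1 else 0 := by
  rw [eigProj, pw_gateZ, ← Matrix.diagonal_one, ← Matrix.diagonal_smul, Matrix.diagonal_add,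
    ← Matrix.diagonal_smul]
  congr 1
  funext u
  simp only [Pi.smul_apply, smul_eq_mul]
  rw [show ((-1 : ℂ) ^ μ.val) = sgn μ from rfl, ← sgn_add]
  rcases zmod_two_cases μ with rfl | rfl <;> rcases zmod_two_cases (f ⬝ᵥ u) with h | h <;>
    rw [h] <;>
    simp only [add_zero, zero_add, show (1 + 1 : ZMod 2) = 0 from rfl, sgn_zero, sgn_one] <;>
    norm_num

/-- All the projectors are diagonal indicators of one parity condition, so their product is the
indicator of the joint condition. -/
theorem list_prod_eigProj {d : ℕ} (z : Fin d → BinVec n) (μ : BinVec d) :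
    (List.ofFn fun i => eigProj (pw gateZ (z i)) (μ i)).prod =
      Matrix.diagonal fun u => if ∀ i, z i ⬝ᵥ u = μ i then 1 else 0 := by
  induction d with
  | zero => simp
  | succ d ih =>
    rw [List.ofFn_succ, List.prod_cons, ih (fun i => z i.succ) fun i => μ i.succ,
      eigProj_diagonal_sgn, Matrix.diagonal_mul_diagonal]
    congr 1
    funext u
    simp only [Fin.forall_fin_succ]
    split_ifs <;> simp_all

theorem run_measureAll_pw_gateZ (d : ℕ) (z : Fin d → BinVec n) (c : BinVec d → Protocol n k)
    (σ : QOp n) :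
    (Protocol.measureAll d (fun i => pw gateZ (z i)) c).run σ =
      ∑ μ : BinVec d, (c μ).run ((List.ofFn fun i => eigProj (pw gateZ (z i)) (μ i)).prod * σ *
        (List.ofFn fun i => eigProj (pw gateZ (z i)) (μ i)).prod) := by
  induction d generalizing σ with
  | zero =>
    simp [Protocol.measureAll]
    congr
  | succ d ih =>
    simp only [Protocol.measureAll, Protocol.run]
    rw [← (Fin.consEquiv fun _ : Fin (d + 1) => ZMod 2).sum_comp, Fintype.sum_prod_type]
    refine Finset.sum_congr rfl fun μ _ => ?_
    rw [ih]
    refine Finset.sum_congr rfl fun ν _ => ?_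
    have hc : Commute (eigProj (pw gateZ (z 0)) μ)
        (List.ofFn fun i : Fin d => eigProj (pw gateZ (z i.succ)) (ν i)).prod := by
      rw [list_prod_eigProj, eigProj_diagonal_sgn]
      exact Matrix.commute_diagonal _ _
    simp only [Fin.consEquiv_apply, List.ofFn_succ, List.prod_cons, Fin.cons_zero, Fin.cons_succ]
    congr 1
    -- On the left of `σ` the successive projectors appear in reverse order; on the right they
    -- already agree.
    nth_rewrite 1 [hc.eq]
    simp only [Matrix.mul_assoc]

/-! ### Discarding qubits -/

theorem padZero_apply (ι : Fin k ↪ Fin n) (x : BinVec k) (a : Fin k) : padZero ι x (ι a) = x a :=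
  ι.injective.extend_apply x 0 a

theorem padZero_apply_of_notMem (ι : Fin k ↪ Fin n) (x : BinVec k) {j : Fin n}
    (hj : j ∉ Set.range ι) : padZero ι x j = 0 := by
  rw [padZero, Function.extend_apply' _ _ _ fun ⟨a, ha⟩ => hj ⟨a, ha⟩]
  rfl

theorem padZero_injective (ι : Fin k ↪ Fin n) : Function.Injective (padZero ι) := fun x y h => by
  funext a
  rw [← padZero_apply ι x, h, padZero_apply]

/-- Discarding qubits in state `|0⟩`. -/
theorem keepQubits_ketbra (ι : Fin k ↪ Fin n) (c : BinVec k → ℂ) :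
    keepQubits ι (ketbra (∑ x, c x • ketBasis (padZero ι x))) = ketbra c := by
  classical
  have h1 : ∀ x, (∑ y, c y • ketBasis (padZero ι y)) (padZero ι x) = c x := by
    intro x
    simp [ketBasis, Finset.sum_apply, Pi.single_apply, (padZero_injective ι).eq_iff]
  -- The vector is supported on padded strings, so fixing the kept bits leaves a single pair `(u,
  -- v)` in the partial trace.
  have h2 : ∀ u : BinVec n, (∑ y, c y • ketBasis (padZero ι y)) u ≠ 0 →
      u = padZero ι fun a => u (ι a) := by
    intro u hu
    rw [Finset.sum_apply] at hu
    obtain ⟨y, -, hy⟩ := Finset.exists_ne_zero_of_sum_ne_zero hu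
    simp only [ketBasis, Pi.smul_apply, Pi.single_apply, smul_eq_mul, ne_eq, mul_eq_zero,
      ite_eq_right_iff, one_ne_zero, imp_false, not_or, not_not] at hy
    rw [hy.2]
    congr 1
    funext a
    rw [padZero_apply]
  ext x y
  rw [keepQubits, Matrix.of_apply, Finset.sum_eq_single (padZero ι x),
    Finset.sum_eq_single (padZero ι y)]
  · rw [if_pos, ketbra_apply, ketbra_apply, h1, h1]
    exact ⟨padZero_apply ι x, padZero_apply ι y, fun j hj => by
      rw [padZero_apply_of_notMem ι x hj, padZero_apply_of_notMem ι y hj]⟩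
  · intro v _ hv
    split_ifs with h
    · rw [ketbra_apply, star_eq_zero.2, mul_zero]
      by_contra h0
      refine hv ((h2 v h0).trans ?_)
      congr 1
      exact funext h.2.1
    · rfl
  · simp
  · intro u _ hu
    refine Finset.sum_eq_zero fun v _ => ?_
    split_ifs with h
    · rw [ketbra_apply]
      by_cases h0 : (∑ y, c y • ketBasis (padZero ι y)) u = 0
      · rw [h0, zero_mul]
      · refine absurd ((h2 u h0).trans ?_) hu
        congr 1
        exact funext h.1
    · rfl
  · simp

end MagicDistillation

namespace MagicDistillation

variable {n k m : ℕ}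

/-! ### Error probabilities -/

theorem errProb_eq_prod (p : ℝ) (f : BinVec n) :
    errProb p f = ∏ j, if f j = 0 then 1 - p else p := by
  have h : n - hammingNorm f = (Finset.univ.filter fun j => f j = 0).card := by
    have h1 := Finset.card_filter_add_card_filter_not (s := (Finset.univ : Finset (Fin n)))
      (fun j => f j = 0)
    rw [Finset.card_univ, Fintype.card_fin] at h1
    simp only [hammingNorm, ne_eq]
    omega
  rw [errProb, h, hammingNorm, Finset.prod_ite, Finset.prod_const, Finset.prod_const]

theorem sum_zmod_two {M : Type*} [AddCommMonoid M] (f : ZMod 2 → M) : ∑ t, f t = f 0 + f 1 :=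
  Fin.sum_univ_two f

/-- Both factors are products over qubits: a qubit outside the support of `g` contributes (1-p) + p
= 1, one inside it (1-p) - p. -/
theorem sum_sgn_mul_errProb (p : ℝ) (g : BinVec n) :
    ∑ f : BinVec n, sgn (g ⬝ᵥ f) * (errProb p f : ℂ) = (1 - 2 * p : ℂ) ^ hammingNorm g := by
  have h : ∀ j, (∑ t : ZMod 2, sgn (g j * t) * (if t = 0 then 1 - p else p : ℂ)) =
      if g j = 0 then 1 else (1 - 2 * p : ℂ) := by
    intro j
    rw [sum_zmod_two]
    rcases zmod_two_cases (g j) with h | h <;> simp [h]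
    ring
  rw [pow_hammingNorm, ← Finset.prod_congr rfl fun j _ => h j, Finset.prod_univ_sum,
    Fintype.piFinset_univ]
  refine Finset.sum_congr rfl fun f _ => ?_
  rw [Finset.prod_mul_distrib, dotProduct, sgn_sum, errProb_eq_prod, Complex.ofReal_prod]
  congr 1
  refine Finset.prod_congr rfl fun j _ => ?_
  split_ifs <;> simp

theorem sum_errProb (p : ℝ) : ∑ f : BinVec n, (errProb p f : ℂ) = 1 := by
  simpa using sum_sgn_mul_errProb p (0 : BinVec n)

open Classical in
/-- Orthogonality of characters. -/
theorem sum_sgn_submodule (W : Submodule (ZMod 2) (BinVec n)) (f : BinVec n) :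
    ∑ g : W, sgn (f ⬝ᵥ (g : BinVec n)) = if f ∈ dualSpace W then (Nat.card W : ℂ) else 0 := by
  split_ifs with hf
  · rw [Finset.sum_congr rfl fun g _ => by rw [hf g g.2, sgn_zero]]
    simp
  · rw [mem_dualSpace] at hf
    push Not at hf
    obtain ⟨h, hW, hh⟩ := hf
    have h1 : f ⬝ᵥ h = 1 := (zmod_two_cases _).resolve_left hh
    -- Translating by an `h` with (f, h) = 1 reverses the sign of every summand, so the sum equals
    -- its own negative.
    have h2 := Equiv.sum_comp (Equiv.addRight (⟨h, hW⟩ : W)) fun g : W => sgn (f ⬝ᵥ (g : BinVec n))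
    simp only [Equiv.coe_addRight, Submodule.coe_add, dotProduct_add, sgn_add, h1, sgn_one,
      mul_neg, mul_one, Finset.sum_neg_distrib] at h2
    linear_combination (-1 / 2 : ℂ) * h2

open Classical in
/-- The MacWilliams identity for the probability of an error in the dual space. -/
theorem sum_dualSpace_errProb (W : Submodule (ZMod 2) (BinVec n)) (p : ℝ) :
    ∑ f : BinVec n with f ∈ dualSpace W, errProb p f =
      (Nat.card W : ℝ)⁻¹ * ∑ f : BinVec n with f ∈ W, (1 - 2 * p) ^ hammingNorm f := by
  have h0 : (Nat.card W : ℂ) ≠ 0 := by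
    rw [Nat.cast_ne_zero]
    exact Nat.card_pos.ne'
  -- One double sum evaluated twice: over `g` first it gives the indicator of the dual space, over
  -- `f` first the powers of 1 - 2p.
  have h1 : ∑ f : BinVec n, ∑ g : W, sgn (f ⬝ᵥ (g : BinVec n)) * (errProb p f : ℂ) =
      ∑ g : W, (1 - 2 * p : ℂ) ^ hammingNorm (g : BinVec n) := by
    rw [Finset.sum_comm]
    refine Finset.sum_congr rfl fun g _ => ?_
    simp only [← sum_sgn_mul_errProb p, dotProduct_comm]
  simp only [← Finset.sum_mul, sum_sgn_submodule, ite_mul, zero_mul, ← Finset.sum_filter,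
    ← Finset.mul_sum] at h1
  rw [eq_comm, inv_mul_eq_iff_eq_mul₀ (by exact_mod_cast h0), ← Complex.ofReal_inj]
  push_cast
  rw [h1]
  exact Finset.sum_subtype _ (fun x => by simp) _

theorem Ps_eq (G : Matrix (Fin m) (Fin n) (ZMod 2)) (p : ℝ) :
    open Classical in Ps G p = (Nat.card (evenSpace G) : ℝ)⁻¹ *
      ∑ f : BinVec n with f ∈ evenSpace G, (1 - 2 * p) ^ hammingNorm f :=
  sum_dualSpace_errProb _ _

/-- In the MacWilliams form every exponent is even, so no term is negative, and the zero vector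
contributes 1. -/
theorem Ps_pos {G : Matrix (Fin m) (Fin n) (ZMod 2)} {hk : k ≤ m} (h : Triorthogonal G hk)
    (p : ℝ) : 0 < Ps G p := by
  classical
  rw [Ps_eq]
  refine mul_pos (inv_pos.2 (Nat.cast_pos.2 Nat.card_pos)) ?_
  refine Finset.sum_pos' (fun f hf => ?_) ⟨0, by simp, by simp⟩
  exact (h.even_hammingNorm_of_mem (Finset.mem_filter.1 hf).2).pow_nonneg _

open Classical in
theorem pOut_eq {G : Matrix (Fin m) (Fin n) (ZMod 2)} {hk : k ≤ m} (h : Triorthogonal G hk)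
    (p : ℝ) (x : BinVec k) :
    pOut G hk p x =
      ∑ f : BinVec n with f ∈ dualSpace (evenSpace G) ∧ oddSyndrome G hk f = x, errProb p f := by
  rw [pOut]
  congr 1
  ext f
  simp [h.mem_dualSpace_evenSpace]

/-- The module `M` is arbitrary so that the same regrouping serves both the total probability and
the output state. -/
theorem sum_pOut_smul {G : Matrix (Fin m) (Fin n) (ZMod 2)} {hk : k ≤ m} (h : Triorthogonal G hk)
    (p : ℝ) {M : Type*} [AddCommGroup M] [Module ℂ M] (F : BinVec k → M) :
    open Classical in
    ∑ f : BinVec n with f ∈ dualSpace (evenSpace G), (errProb p f : ℂ) • F (oddSyndrome G hk f) =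
      ∑ x, (pOut G hk p x : ℂ) • F x := by
  classical
  rw [← Finset.sum_fiberwise _ (oddSyndrome G hk)]
  refine Finset.sum_congr rfl fun x _ => ?_
  rw [pOut_eq h, Complex.ofReal_sum, Finset.sum_smul, Finset.filter_filter]
  refine Finset.sum_congr rfl fun f hf => ?_
  rw [(Finset.mem_filter.1 hf).2.2]

theorem sum_pOut {G : Matrix (Fin m) (Fin n) (ZMod 2)} {hk : k ≤ m} (h : Triorthogonal G hk)
    (p : ℝ) : ∑ x, (pOut G hk p x : ℂ) = Ps G p := by
  have h1 := sum_pOut_smul h p fun _ => (1 : ℂ)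
  simp only [smul_eq_mul, mul_one] at h1
  rw [← h1, Ps, Complex.ofReal_sum]

/-! ### The input state -/

/-- The normalization `2^{-n/2}`. -/
noncomputable def plusAmp (n : ℕ) : ℂ := ((Real.sqrt 2)⁻¹ : ℝ) ^ n

theorem plusAmp_mul_star (n : ℕ) : plusAmp n * star (plusAmp n) = ((2 : ℂ) ^ n)⁻¹ := by
  rw [plusAmp, star_pow, Complex.star_def, Complex.conj_ofReal, ← mul_pow, ← Complex.ofReal_mul,
    ← mul_inv, Real.mul_self_sqrt zero_le_two, Complex.ofReal_inv, inv_pow]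
  norm_num

theorem plusAmp_ne_zero (n : ℕ) : plusAmp n ≠ 0 := by
  rw [plusAmp]
  refine pow_ne_zero _ (Complex.ofReal_ne_zero.2 (inv_ne_zero ?_))
  exact (Real.sqrt_pos.2 zero_lt_two).ne'

theorem ketA_apply (s t : ZMod 2) :
    ketA s t = plusAmp 1 * sgn (s * t) * (if t = 0 then 1 else omega8) := by
  rw [ketA, gateZ_pow, Matrix.mulVec_diagonal, gateT, Matrix.mulVec_diagonal, ketPlus, plusAmp,
    pow_one]
  ring

theorem ketAx_apply (x u : BinVec n) :
    ketAx x u = plusAmp n * (sgn (x ⬝ᵥ u) * omega8 ^ hammingNorm u) := by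
  rw [ketAx, Finset.prod_congr rfl fun a _ => ketA_apply (x a) (u a), Finset.prod_mul_distrib,
    Finset.prod_mul_distrib, pow_hammingNorm, dotProduct, sgn_sum, Finset.prod_const, plusAmp,
    plusAmp, pow_one, Finset.card_univ, Fintype.card_fin, mul_assoc]

/-- Expanding the tensor power of a two-term mixture: `f` records which qubits carry |A₁⟩. -/
theorem rawInput_eq (p : ℝ) :
    rawInput n p = ∑ f : BinVec n, (errProb p f : ℂ) • ketbra (ketAx f) := by
  ext u v
  have h : ∀ j, rawAncilla p (u j) (v j) = ∑ t : ZMod 2,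
      (if t = 0 then 1 - p else p : ℂ) * (ketA t (u j) * star (ketA t (v j))) := by
    intro j
    rw [sum_zmod_two]
    simp [rawAncilla, ketbra_apply]
  rw [rawInput, tensorOp, Matrix.of_apply, Finset.prod_congr rfl fun j _ => h j,
    Finset.prod_univ_sum, Fintype.piFinset_univ, Matrix.sum_apply]
  refine Finset.sum_congr rfl fun f _ => ?_
  rw [Matrix.smul_apply, ketbra_apply, smul_eq_mul, ketAx, ketAx, errProb_eq_prod,
    Complex.ofReal_prod, star_prod, Finset.prod_mul_distrib, Finset.prod_mul_distrib]
  congr 1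
  refine Finset.prod_congr rfl fun j _ => ?_
  split_ifs <;> simp

theorem zNoise_ketbra (p : ℝ) (ψ : BinVec n → ℂ) :
    zNoise p (ketbra ψ) = ∑ f : BinVec n, (errProb p f : ℂ) • ketbra (pw gateZ f *ᵥ ψ) := by
  refine Finset.sum_congr rfl fun f _ => ?_
  rw [← mul_ketbra_mul, (pw_gateZ_isHermitian f).eq]

theorem zNoise_smul (p : ℝ) (c : ℂ) (σ : QOp n) : zNoise p (c • σ) = c • zNoise p σ := by
  rw [zNoise, zNoise, Finset.smul_sum]
  refine Finset.sum_congr rfl fun f _ => ?_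
  rw [Matrix.mul_smul, Matrix.smul_mul, smul_comm]

theorem mainState_eq (G : Matrix (Fin m) (Fin n) (ZMod 2)) (p : ℝ) :
    mainState G p = (Nat.card (rowSpace G) : ℂ)⁻¹ • ∑ f : BinVec n, (errProb p f : ℂ) •
      ketbra (pw gateZ f *ᵥ ((tensorOp fun _ => gateT) *ᵥ ketSpace (rowSpace G))) := by
  rw [mainState, Matrix.mul_smul, Matrix.smul_mul, mul_ketbra_mul, zNoise_smul, zNoise_ketbra]

theorem trace_ketbra {α : Type} [Fintype α] (ψ : α → ℂ) :
    (ketbra ψ).trace = ∑ u, ψ u * star (ψ u) := rfl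

theorem star_omega8_pow_mul (a : ℕ) : omega8 ^ a * star (omega8 ^ a) = 1 := by
  rw [star_pow, ← mul_pow, mul_comm, star_omega8_mul, one_pow]

theorem trace_ketbra_ketAx (x : BinVec k) : (ketbra (ketAx x)).trace = 1 := by
  have h : ∀ u, ketAx x u * star (ketAx x u) = ((2 : ℂ) ^ k)⁻¹ := by
    intro u
    rw [ketAx_apply, star_mul', star_mul', star_sgn, ← plusAmp_mul_star]
    linear_combination (plusAmp k * star (plusAmp k)) *
      (omega8 ^ hammingNorm u * star (omega8 ^ hammingNorm u)) * sgn_mul_self (x ⬝ᵥ u) +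
      (plusAmp k * star (plusAmp k)) * star_omega8_pow_mul (hammingNorm u)
  rw [trace_ketbra, Finset.sum_congr rfl fun u _ => h u, Finset.sum_const, Finset.card_univ]
  simp

/-! ### The encoded states -/

theorem list_prod_one_add (f : Fin k → BinVec n) :
    (List.ofFn fun a => (1 : QOp n) + omega8 • pw gateX (f a)).prod =
      ∑ x : BinVec k, omega8 ^ hammingNorm x • pw gateX (∑ a, x a • f a) := by
  induction k with
  | zero => simp [pw_zero, pow_hammingNorm]
  | succ k ih =>
    rw [← (Fin.consEquiv fun _ : Fin (k + 1) => ZMod 2).sum_comp, Fintype.sum_prod_type,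
      sum_zmod_two, List.ofFn_succ, List.prod_cons, ih, Matrix.add_mul, Matrix.one_mul,
      Finset.mul_sum]
    congr 1
    · refine Finset.sum_congr rfl fun x _ => ?_
      simp [Fin.sum_univ_succ, pow_hammingNorm, Fin.prod_univ_succ]
    · refine Finset.sum_congr rfl fun x _ => ?_
      simp [Fin.sum_univ_succ, pow_hammingNorm, Fin.prod_univ_succ, smul_smul, ← pw_gateX_mul,
        mul_comm]

theorem encodedA_eq (G : Matrix (Fin m) (Fin n) (ZMod 2)) (hk : k ≤ m) :
    encodedA G hk = ∑ x : BinVec k, omega8 ^ hammingNorm x • encodedBasis G hk x := by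
  rw [encodedA, list_prod_one_add, Matrix.sum_mulVec]
  simp only [Matrix.smul_mulVec]
  rfl

theorem pw_gateX_mulVec_ketSpace {W : Submodule (ZMod 2) (BinVec n)} {g : BinVec n} (hg : g ∈ W) :
    pw gateX g *ᵥ ketSpace W = ketSpace W := by
  funext u
  rw [pw_gateX_mulVec, ketSpace, ketSpace]
  by_cases hu : u ∈ W
  · rw [if_pos hu, if_pos (add_mem hu hg)]
  · rw [if_neg hu, if_neg fun h => hu ((Submodule.add_mem_iff_left W hg).1 h)]

theorem pw_gateZ_mulVec_ketSpace {W : Submodule (ZMod 2) (BinVec n)} {f : BinVec n}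
    (hf : f ∈ dualSpace W) : pw gateZ f *ᵥ ketSpace W = ketSpace W := by
  funext u
  rw [pw_gateZ_mulVec, ketSpace]
  split_ifs with hu
  · rw [hf u hu, sgn_zero, one_mul]
  · rw [mul_zero]

variable {G : Matrix (Fin m) (Fin n) (ZMod 2)} {hk : k ≤ m}

theorem encodedBasis_apply (x : BinVec k) (u : BinVec n) :
    encodedBasis G hk x u = ketSpace (evenSpace G) (u + oddComb G hk x) :=
  pw_gateX_mulVec _ _ _

theorem pw_gateX_mulVec_encodedBasis {g : BinVec n} (hg : g ∈ evenSpace G) (x : BinVec k) :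
    pw gateX g *ᵥ encodedBasis G hk x = encodedBasis G hk x := by
  rw [encodedBasis, Matrix.mulVec_mulVec, pw_gateX_mul, add_comm, ← pw_gateX_mul,
    ← Matrix.mulVec_mulVec, pw_gateX_mulVec_ketSpace hg]

theorem pw_gateX_mulVec_encodedA {g : BinVec n} (hg : g ∈ evenSpace G) :
    pw gateX g *ᵥ encodedA G hk = encodedA G hk := by
  rw [encodedA_eq, Matrix.mulVec_sum]
  simp only [Matrix.mulVec_smul, pw_gateX_mulVec_encodedBasis hg]

/-- An undetected Z-error fixes |G₀⟩, so its only effect is the sign from commuting past the logical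
X operator. -/
theorem pw_gateZ_mulVec_encodedBasis {f : BinVec n} (hf : f ∈ dualSpace (evenSpace G))
    (x : BinVec k) :
    pw gateZ f *ᵥ encodedBasis G hk x = sgn (oddSyndrome G hk f ⬝ᵥ x) • encodedBasis G hk x := by
  rw [encodedBasis, Matrix.mulVec_mulVec, pw_gateZ_mul_pw_gateX, Matrix.smul_mulVec,
    ← Matrix.mulVec_mulVec, pw_gateZ_mulVec_ketSpace hf, dotProduct_oddComb]

theorem IsDecoder.mulVec {ι : Fin k ↪ Fin n} {D : QOp n} (hD : IsDecoder G hk ι D)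
    (x : BinVec k) :
    D *ᵥ encodedBasis G hk x =
      (Real.sqrt (Nat.card (evenSpace G)) : ℂ) • ketBasis (padZero ι x) := by
  have h0 : (Real.sqrt (Nat.card (evenSpace G)) : ℂ) ≠ 0 :=
    Complex.ofReal_ne_zero.2 (Real.sqrt_pos.2 (Nat.cast_pos.2 Nat.card_pos)).ne'
  rw [← hD.2 x, Matrix.mulVec_smul, ← Complex.coe_smul, smul_smul, Complex.ofReal_inv,
    mul_inv_cancel₀ h0, one_smul]

theorem IsDecoder.run_output {ι : Fin k ↪ Fin n} {D : QOp n} (hD : IsDecoder G hk ι D)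
    {f : BinVec n} (hf : f ∈ dualSpace (evenSpace G)) :
    keepQubits ι (D * ketbra (pw gateZ f *ᵥ encodedA G hk) * Dᴴ) =
      ((2 : ℂ) ^ k * Nat.card (evenSpace G)) • ketbra (ketAx (oddSyndrome G hk f)) := by
  -- The sign of the error times ω^{|x|} is the amplitude of |A_x⟩ up to normalization. The square
  -- root normalizes the encoded basis states, and the inverse amplitude appears because `encodedA`
  -- lacks the factor 2^{-k/2}.
  have h1 : D *ᵥ (pw gateZ f *ᵥ encodedA G hk) =
      (Real.sqrt (Nat.card (evenSpace G)) * (plusAmp k)⁻¹ : ℂ) •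
        ∑ x, ketAx (oddSyndrome G hk f) x • ketBasis (padZero ι x) := by
    rw [encodedA_eq, Matrix.mulVec_sum, Matrix.mulVec_sum, Finset.smul_sum]
    refine Finset.sum_congr rfl fun x _ => ?_
    rw [Matrix.mulVec_smul, Matrix.mulVec_smul, pw_gateZ_mulVec_encodedBasis hf,
      Matrix.mulVec_smul, hD.mulVec, smul_smul, smul_smul, smul_smul, ketAx_apply]
    congr 1
    field_simp [plusAmp_ne_zero k]
  rw [mul_ketbra_mul, h1, ketbra_smul, keepQubits_smul, keepQubits_ketbra]
  congr 1
  have h2 := plusAmp_mul_star k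
  have h3 : (Real.sqrt (Nat.card (evenSpace G)) : ℂ) * Real.sqrt (Nat.card (evenSpace G)) =
      Nat.card (evenSpace G) := by
    rw [← Complex.ofReal_mul, Real.mul_self_sqrt (Nat.cast_nonneg _), Complex.ofReal_natCast]
  rw [star_mul', star_inv₀, Complex.star_def, Complex.conj_ofReal, ← Complex.star_def,
    mul_mul_mul_comm, h3, ← mul_inv, h2, inv_inv, mul_comm]

end MagicDistillation

namespace MagicDistillation

variable {n k m : ℕ} {G : Matrix (Fin m) (Fin n) (ZMod 2)} {hk : k ≤ m}

/-! ### The part common to both subroutines -/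

/-- Diagonality is what lets `U` commute with Z-errors. -/
theorem exists_diagonal_of_mem_czsMonoid {U : QOp n} (hU : U ∈ czsMonoid n) :
    ∃ φ : BinVec n → ℂ, U = Matrix.diagonal φ := by
  induction hU using Submonoid.closure_induction with
  | mem V hV =>
    rcases hV with ⟨p, rfl⟩ | ⟨p, q, -, rfl⟩
    · simp only [sOn, pw, gateS_pow, tensorOp_diagonal]
      exact ⟨_, rfl⟩
    · exact ⟨_, rfl⟩
  | one => exact ⟨1, Matrix.diagonal_one.symm⟩
  | mul V W _ _ hV hW =>
    obtain ⟨φ, rfl⟩ := hV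
    obtain ⟨χ, rfl⟩ := hW
    exact ⟨_, Matrix.diagonal_mul_diagonal _ _⟩

-- For a fixed error the measured X(g) have a joint eigenvector, so the outcome is deterministic:
-- either certain failure or one definite |A_x⟩. Only the span of the `g i` matters, so dependent
-- rows and bases are both covered.
open Classical in
theorem run_postselectAndDecode {r : ℕ} {U D : QOp n} {ι : Fin k ↪ Fin n} {g : Fin r → BinVec n}
    (hg : evenSpace G = Submodule.span (ZMod 2) (Set.range g)) (hU : IsPhaseCorrection G hk U)
    (hD : IsDecoder G hk ι D) (f : BinVec n) :
    (postselectAndDecode U g D ι).run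
        (ketbra (pw gateZ f *ᵥ ((tensorOp fun _ => gateT) *ᵥ ketSpace (rowSpace G)))) =
      if f ∈ dualSpace (evenSpace G) then
        ((2 : ℂ) ^ k * Nat.card (evenSpace G)) • ketbra (ketAx (oddSyndrome G hk f)) else 0 := by
  have hUZ : U *ᵥ (pw gateZ f *ᵥ ((tensorOp fun _ => gateT) *ᵥ ketSpace (rowSpace G))) =
      pw gateZ f *ᵥ encodedA G hk := by
    obtain ⟨φ, hφ⟩ := exists_diagonal_of_mem_czsMonoid hU.1
    have hc : Commute U (pw gateZ f) := by
      rw [hφ, pw_gateZ]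
      exact Matrix.commute_diagonal _ _
    rw [Matrix.mulVec_mulVec _ U, hc.eq, ← Matrix.mulVec_mulVec, hU.2]
  have hX : ∀ i, pw gateX (g i) *ᵥ (pw gateZ f *ᵥ encodedA G hk) =
      sgn (f ⬝ᵥ g i) • (pw gateZ f *ᵥ encodedA G hk) := by
    intro i
    have hi : g i ∈ evenSpace G := by
      rw [hg]
      exact Submodule.subset_span ⟨i, rfl⟩
    have h1 : pw gateX (g i) * pw gateZ f = sgn (f ⬝ᵥ g i) • (pw gateZ f * pw gateX (g i)) := by
      rw [pw_gateZ_mul_pw_gateX, smul_smul, sgn_mul_self, one_smul]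
    rw [Matrix.mulVec_mulVec, h1, Matrix.smul_mulVec, ← Matrix.mulVec_mulVec,
      pw_gateX_mulVec_encodedA hi]
  have hf : (fun i => f ⬝ᵥ g i) = 0 ↔ f ∈ dualSpace (evenSpace G) := by
    rw [hg, mem_dualSpace_span, Set.forall_mem_range, funext_iff]
    rfl
  rw [postselectAndDecode, Protocol.run, mul_ketbra_mul, hUZ,
    run_measureAll_of_eigenvector r _ (fun i => pw_gateX_isHermitian _) _ hX]
  by_cases h : f ∈ dualSpace (evenSpace G)
  · rw [if_pos (hf.2 h), if_pos h, Protocol.run, Protocol.run, hD.run_output h]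
  · rw [if_neg (fun h' => h (hf.1 h')), if_neg h, Protocol.run]

theorem run_postselectAndDecode_mainState (h : Triorthogonal G hk) {r : ℕ} {U D : QOp n}
    {ι : Fin k ↪ Fin n} {g : Fin r → BinVec n}
    (hg : evenSpace G = Submodule.span (ZMod 2) (Set.range g)) (hU : IsPhaseCorrection G hk U)
    (hD : IsDecoder G hk ι D) (p : ℝ) :
    (postselectAndDecode U g D ι).run (mainState G p) =
      ∑ x, (pOut G hk p x : ℂ) • ketbra (ketAx x) := by
  classical
  have h0 : ((2 : ℂ) ^ k * Nat.card (evenSpace G)) ≠ 0 :=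
    mul_ne_zero (pow_ne_zero _ two_ne_zero) (Nat.cast_ne_zero.2 Nat.card_pos.ne')
  rw [mainState_eq, Protocol.run_smul, Protocol.run_sum, ← sum_pOut_smul h p, h.natCard_rowSpace,
    Finset.sum_filter, Finset.smul_sum]
  refine Finset.sum_congr rfl fun f _ => ?_
  rw [Protocol.run_smul, run_postselectAndDecode hg hU hD]
  split_ifs
  -- The normalization |𝒢|⁻¹ of the input cancels the norm factor 2^k |𝒢₀|.
  · rw [smul_smul, smul_smul]
    congr 1
    push_cast
    field_simp
  · simp

theorem trace_sum_pOut (h : Triorthogonal G hk) (p : ℝ) :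
    (∑ x, (pOut G hk p x : ℂ) • ketbra (ketAx x)).trace = (Ps G p : ℂ) := by
  simp only [Matrix.trace_sum, Matrix.trace_smul, trace_ketbra_ketAx, smul_eq_mul, mul_one,
    sum_pOut h]

theorem Protocol.successProb_outputState (h : Triorthogonal G hk) {p : ℝ} {q : Protocol n k}
    {σ : QOp n} (hq : q.run σ = ∑ x, (pOut G hk p x : ℂ) • ketbra (ketAx x)) :
    q.successProb σ = (Ps G p : ℂ) ∧ q.outputState σ = rhoOut G hk p := by
  have h1 : q.successProb σ = (Ps G p : ℂ) := by rw [successProb, hq, trace_sum_pOut h]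
  exact ⟨h1, by rw [outputState, h1, hq, rhoOut]⟩

/-! ### The alternative subroutine -/

theorem trace_mainState (p : ℝ) : (mainState G p).trace = 1 := by
  classical
  have h : ∀ f : BinVec n, (ketbra (pw gateZ f *ᵥ ((tensorOp fun _ => gateT) *ᵥ
      ketSpace (rowSpace G)))).trace = Nat.card (rowSpace G) := by
    intro f
    rw [trace_ketbra, Nat.card_eq_fintype_card, Fintype.card_subtype, Finset.card_filter,
      Nat.cast_sum]
    refine Finset.sum_congr rfl fun u _ => ?_
    rw [pw_gateZ_mulVec, tensorOp_gateT, Matrix.mulVec_diagonal, ketSpace]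
    by_cases hu : u ∈ rowSpace G
    · simp only [if_pos hu, mul_one, star_mul', star_sgn, Nat.cast_one]
      linear_combination (omega8 ^ hammingNorm u * star (omega8 ^ hammingNorm u)) *
        sgn_mul_self (f ⬝ᵥ u) + star_omega8_pow_mul (hammingNorm u)
    · simp [hu]
  rw [mainState_eq, Matrix.trace_smul, Matrix.trace_sum]
  simp only [Matrix.trace_smul, h, smul_eq_mul, ← Finset.sum_mul, sum_errProb, one_mul]
  exact inv_mul_cancel₀ (Nat.cast_ne_zero.2 (Nat.card_pos (α := rowSpace G)).ne')

theorem pw_gateA_mul_self (w : BinVec n) : pw gateA w * pw gateA w = 1 := by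
  rw [pw_gateA, Matrix.mul_assoc, ← Matrix.mul_assoc _ _ (tensorOp fun _ => gateT)ᴴ,
    ← Matrix.mul_assoc _ (tensorOp fun _ => gateT), tensorOp_gateT_conjTranspose_mul,
    Matrix.one_mul, Matrix.mul_assoc, ← Matrix.mul_assoc (pw gateX w), pw_gateX_mul,
    binVec_add_self, pw_zero, Matrix.one_mul, tensorOp_gateT_mul_conjTranspose]

namespace AltChoices

variable (C : AltChoices G hk)

-- Having the same syndrome as `w` means differing from it by an element of (𝒢^⊥)^⊥ = 𝒢.
open Classical in
theorem syndromeProj_eq (μ : BinVec C.d) :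
    C.syndromeProj μ = Matrix.diagonal fun u => if u + C.w μ ∈ rowSpace G then 1 else 0 := by
  rw [syndromeProj, list_prod_eigProj]
  congr 1
  funext u
  refine if_congr ?_ rfl rfl
  have h : u + C.w μ ∈ rowSpace G ↔ ∀ i, (u + C.w μ) ⬝ᵥ (C.zBasis i : BinVec n) = 0 := by
    have h1 := mem_dualSpace_span (s := Set.range fun i => (C.zBasis i : BinVec n))
      (f := u + C.w μ)
    rwa [basis_span, dualSpace_dualSpace, Set.forall_mem_range] at h1
  rw [h]
  refine forall_congr' fun i => ?_
  rw [add_dotProduct, C.w_spec, dotProduct_comm]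
  constructor
  · rintro h
    rw [h, CharTwo.add_self_eq_zero]
  · intro h
    exact CharTwo.add_eq_zero.1 h

theorem syndromeProj_isHermitian (μ : BinVec C.d) : (C.syndromeProj μ).IsHermitian := by
  classical
  rw [syndromeProj_eq]
  apply Matrix.isHermitian_diagonal_of_self_adjoint
  ext u
  simp [apply_ite star]

theorem syndromeProj_mulVec_ketAx (μ : BinVec C.d) (f : BinVec n) :
    C.syndromeProj μ *ᵥ ketAx f = plusAmp n • (pw gateZ f *ᵥ ((tensorOp fun _ => gateT) *ᵥ
      (pw gateX (C.w μ) *ᵥ ketSpace (rowSpace G)))) := by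
  funext u
  rw [syndromeProj_eq, Matrix.mulVec_diagonal, ketAx_apply, Pi.smul_apply, pw_gateZ_mulVec,
    tensorOp_gateT, Matrix.mulVec_diagonal, pw_gateX_mulVec, ketSpace, smul_eq_mul]
  ring

/-- A(w) passes Z(f) at the cost of a sign, then acts under T^{⊗n} as X(w), which squares to 1. -/
theorem pw_gateA_mulVec_coset (w f : BinVec n) :
    pw gateA w *ᵥ (pw gateZ f *ᵥ ((tensorOp fun _ => gateT) *ᵥ
      (pw gateX w *ᵥ ketSpace (rowSpace G)))) =
    sgn (f ⬝ᵥ w) • (pw gateZ f *ᵥ ((tensorOp fun _ => gateT) *ᵥ ketSpace (rowSpace G))) := by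
  rw [Matrix.mulVec_mulVec, pw_gateA_mul_pw_gateZ, Matrix.smul_mulVec, ← Matrix.mulVec_mulVec,
    Matrix.mulVec_mulVec _ (pw gateA w), pw_gateA_mul_tensorOp_gateT, ← Matrix.mulVec_mulVec,
    Matrix.mulVec_mulVec _ (pw gateX w), pw_gateX_mul, binVec_add_self, pw_zero, Matrix.one_mulVec]

theorem d_add_finrank : C.d + Module.finrank (ZMod 2) (rowSpace G) = n := by
  have h := finrank_dualSpace (rowSpace G)
  rwa [Module.finrank_eq_card_basis C.zBasis, Fintype.card_fin] at h

/-- After the correction `A(w)†` every syndrome leads to the state of the main subroutine. -/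
theorem correction_syndromeProj (p : ℝ) (μ : BinVec C.d) :
    (pw gateA (C.w μ))ᴴ * (C.syndromeProj μ * rawInput n p * C.syndromeProj μ) *
      (pw gateA (C.w μ))ᴴᴴ = ((2 : ℂ) ^ C.d)⁻¹ • mainState G p := by
  have h1 : ∀ f, C.syndromeProj μ * ketbra (ketAx f) * C.syndromeProj μ =
      ketbra (C.syndromeProj μ *ᵥ ketAx f) := fun f => by
    rw [← mul_ketbra_mul, (C.syndromeProj_isHermitian μ).eq]
  -- The probability 2^{-n} of one string splits as 2^{-d} for the syndrome and 1/|𝒢| inside its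
  -- coset, since d + dim 𝒢 = n.
  have h2 : plusAmp n * star (plusAmp n) =
      ((2 : ℂ) ^ C.d)⁻¹ * (Nat.card (rowSpace G) : ℂ)⁻¹ := by
    rw [plusAmp_mul_star, natCard_submodule, ← mul_inv]
    push_cast
    rw [← pow_add, C.d_add_finrank]
  rw [rawInput_eq, mainState_eq, smul_smul, Matrix.mul_sum, Matrix.sum_mul, Matrix.mul_sum,
    Matrix.sum_mul, Finset.smul_sum]
  refine Finset.sum_congr rfl fun f _ => ?_
  rw [Matrix.mul_smul, Matrix.smul_mul, h1, Matrix.mul_smul, Matrix.smul_mul, mul_ketbra_mul,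
    (pw_gateA_isHermitian (C.w μ)).eq, syndromeProj_mulVec_ketAx, Matrix.mulVec_smul,
    pw_gateA_mulVec_coset, ketbra_smul, ketbra_sgn_smul, h2, smul_comm]

/-- The correction preserves the trace, and the state of the main subroutine has trace 1. -/
theorem trace_syndromeProj (p : ℝ) (μ : BinVec C.d) :
    (C.syndromeProj μ * rawInput n p * C.syndromeProj μ).trace = ((2 : ℂ) ^ C.d)⁻¹ := by
  have h := congrArg Matrix.trace (C.correction_syndromeProj p μ)
  rw [Matrix.trace_smul, trace_mainState, smul_eq_mul, mul_one, Matrix.trace_mul_comm,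
    ← Matrix.mul_assoc, Matrix.conjTranspose_conjTranspose, (pw_gateA_isHermitian (C.w μ)).eq,
    pw_gateA_mul_self, Matrix.one_mul] at h
  exact h

theorem run_afterSyndrome (h : Triorthogonal G hk) (p : ℝ) (μ : BinVec C.d) :
    (C.afterSyndrome μ).run (C.syndromeProj μ * rawInput n p * C.syndromeProj μ) =
      ((2 : ℂ) ^ C.d)⁻¹ • ∑ x, (pOut G hk p x : ℂ) • ketbra (ketAx x) := by
  rw [afterSyndrome, Protocol.run, correction_syndromeProj, Protocol.run_smul,
    run_postselectAndDecode_mainState h (basis_span C.xBasis).symm C.U_spec C.D_spec]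

theorem run_protocol (h : Triorthogonal G hk) (p : ℝ) :
    C.protocol.run (rawInput n p) = ∑ x, (pOut G hk p x : ℂ) • ketbra (ketAx x) := by
  rw [protocol, run_measureAll_pw_gateZ]
  refine (Finset.sum_congr rfl fun μ _ => C.run_afterSyndrome h p μ).trans ?_
  rw [Finset.sum_const, Finset.card_univ, ← Nat.cast_smul_eq_nsmul ℂ, smul_smul]
  simp

/-- There are d = n - dim 𝒢 measurements of Z type and dim 𝒢₀ = dim 𝒢 - k of X type. -/
theorem numMeasurements_protocol (h : Triorthogonal G hk) :
    C.protocol.numMeasurements + k = n := by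
  have h1 : ∀ μ, (C.afterSyndrome μ).numMeasurements = C.r := by
    intro μ
    rw [afterSyndrome, Protocol.numMeasurements, postselectAndDecode, Protocol.numMeasurements,
      Protocol.numMeasurements_measureAll 0, add_zero]
    intro ν
    split_ifs <;> rfl
  have h2 := C.d_add_finrank
  have h3 := Module.finrank_eq_card_basis C.xBasis
  rw [Fintype.card_fin] at h3
  rw [protocol, Protocol.numMeasurements_measureAll C.r _ _ _ h1]
  rw [h.finrank_rowSpace] at h2
  omega

end AltChoices

end MagicDistillation

namespace MagicDistillation

variable {n k m : ℕ}

/-! ### The Pauli group -/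

/-- The one-qubit Pauli group. -/
def gatePauli : Set Gate := {P | ∃ (ω : ℕ) (s t : ZMod 2),
  P = Complex.I ^ ω • (gateX ^ s.val * gateZ ^ t.val)}

theorem exists_I_pow_eq_sgn (t : ZMod 2) : ∃ ω : ℕ, sgn t = Complex.I ^ ω := by
  rcases zmod_two_cases t with rfl | rfl
  · exact ⟨0, by simp⟩
  · exact ⟨2, by simp⟩

theorem gatePauli_cases {P : Gate} (hP : P ∈ gatePauli) :
    ∃ (ω : ℕ) (Q : Gate), (Q = 1 ∨ Q = gateX ∨ Q = gateY ∨ Q = gateZ) ∧ P = Complex.I ^ ω • Q := by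
  obtain ⟨ω, s, t, rfl⟩ := hP
  rcases zmod_two_cases s with rfl | rfl <;> rcases zmod_two_cases t with rfl | rfl <;>
    simp only [ZMod.val_zero, ZMod.val_one, pow_zero, pow_one, one_mul, mul_one]
  · exact ⟨ω, 1, by simp, rfl⟩
  · exact ⟨ω, gateZ, by simp, rfl⟩
  · exact ⟨ω, gateX, by simp, rfl⟩
  -- Y = iXZ, hence XZ = i³Y.
  · refine ⟨ω + 3, gateY, by simp, ?_⟩
    rw [gateY, smul_smul, ← pow_succ, add_assoc, pow_add, Complex.I_pow_four, mul_one]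

theorem mem_pauliGroup_iff_gatePauli {P : QOp n} :
    P ∈ pauliGroup n ↔
      ∃ (ω : ℕ) (Q : Fin n → Gate), (∀ j, Q j ∈ gatePauli) ∧ P = Complex.I ^ ω • tensorOp Q := by
  constructor
  · rintro ⟨ω, Q, hQ, rfl⟩
    refine ⟨ω, Q, fun j => ?_, rfl⟩
    rcases hQ j with h | h | h | h <;> rw [h]
    · exact ⟨0, 0, 0, by simp⟩
    · exact ⟨0, 1, 0, by simp [ZMod.val_one]⟩
    · exact ⟨1, 1, 1, by simp [ZMod.val_one, gateY]⟩
    · exact ⟨0, 0, 1, by simp [ZMod.val_one]⟩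
  · rintro ⟨ω, Q, hQ, rfl⟩
    choose a R hR hQR using fun j => gatePauli_cases (hQ j)
    refine ⟨ω + ∑ j, a j, R, hR, ?_⟩
    rw [funext hQR, tensorOp_smul, smul_smul, Finset.prod_pow_eq_pow_sum, pow_add]

theorem mem_pauliGroup_iff {P : QOp n} :
    P ∈ pauliGroup n ↔
      ∃ (ω : ℕ) (f g : BinVec n), P = Complex.I ^ ω • (pw gateX f * pw gateZ g) := by
  rw [mem_pauliGroup_iff_gatePauli]
  constructor
  · rintro ⟨ω, Q, hQ, rfl⟩
    choose a f g hQ using hQ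
    refine ⟨ω + ∑ j, a j, f, g, ?_⟩
    rw [funext hQ, tensorOp_smul, smul_smul, Finset.prod_pow_eq_pow_sum, pow_add, pw, pw,
      tensorOp_mul]
  · rintro ⟨ω, f, g, rfl⟩
    refine ⟨ω, fun j => gateX ^ (f j).val * gateZ ^ (g j).val,
      fun j => ⟨0, f j, g j, by simp⟩, ?_⟩
    rw [pw, pw, tensorOp_mul]

theorem pw_gateX_mem_pauliGroup (f : BinVec n) : pw gateX f ∈ pauliGroup n :=
  mem_pauliGroup_iff.2 ⟨0, f, 0, by simp [pw_zero]⟩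

theorem pw_gateZ_mem_pauliGroup (f : BinVec n) : pw gateZ f ∈ pauliGroup n :=
  mem_pauliGroup_iff.2 ⟨0, 0, f, by simp [pw_zero]⟩

theorem I_pow_smul_mem_pauliGroup {P : QOp n} (hP : P ∈ pauliGroup n) (ω : ℕ) :
    Complex.I ^ ω • P ∈ pauliGroup n := by
  obtain ⟨a, Q, hQ, rfl⟩ := hP
  exact ⟨ω + a, Q, hQ, by rw [smul_smul, pow_add]⟩

theorem sgn_smul_mem_pauliGroup {P : QOp n} (hP : P ∈ pauliGroup n) (t : ZMod 2) :
    sgn t • P ∈ pauliGroup n := by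
  obtain ⟨ω, hω⟩ := exists_I_pow_eq_sgn t
  rw [hω]
  exact I_pow_smul_mem_pauliGroup hP ω

theorem mul_mem_pauliGroup {P Q : QOp n} (hP : P ∈ pauliGroup n) (hQ : Q ∈ pauliGroup n) :
    P * Q ∈ pauliGroup n := by
  obtain ⟨a, f, g, rfl⟩ := mem_pauliGroup_iff.1 hP
  obtain ⟨b, f', g', rfl⟩ := mem_pauliGroup_iff.1 hQ
  obtain ⟨c, hc⟩ := exists_I_pow_eq_sgn (g ⬝ᵥ f')
  refine mem_pauliGroup_iff.2 ⟨a + b + c, f + f', g + g', ?_⟩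
  rw [← pw_gateX_mul, ← pw_gateZ_mul, Matrix.smul_mul, Matrix.mul_smul, smul_smul, ← pow_add,
    pow_add _ (a + b), ← hc, ← smul_smul, Matrix.mul_assoc, ← Matrix.mul_assoc (pw gateZ g),
    pw_gateZ_mul_pw_gateX, Matrix.smul_mul, Matrix.mul_smul]
  simp only [Matrix.mul_assoc]

theorem finite_pauliGroup : (pauliGroup n).Finite := by
  refine (Set.finite_range fun t : Fin 4 × BinVec n × BinVec n =>
    Complex.I ^ (t.1 : ℕ) • (pw gateX t.2.1 * pw gateZ t.2.2)).subset ?_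
  intro P hP
  obtain ⟨ω, f, g, rfl⟩ := mem_pauliGroup_iff.1 hP
  exact ⟨⟨⟨ω % 4, Nat.mod_lt _ (by norm_num)⟩, f, g⟩, by simp only [← Complex.I_pow_eq_pow_mod]⟩

/-! ### Clifford operators -/

theorem conj_mul_conj {α : Type} [Fintype α] [DecidableEq α] {V : Matrix α α ℂ}
    (hV : V ∈ Matrix.unitaryGroup α ℂ) (P Q : Matrix α α ℂ) :
    V * (P * Q) * Vᴴ = (V * P * Vᴴ) * (V * Q * Vᴴ) := by
  have h : Vᴴ * V = 1 := Matrix.mem_unitaryGroup_iff'.1 hV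
  rw [Matrix.mul_assoc (V * P), Matrix.mul_assoc V Q, ← Matrix.mul_assoc Vᴴ, h, Matrix.one_mul]
  simp only [Matrix.mul_assoc]

theorem conj_injective {α : Type} [Fintype α] [DecidableEq α] {V : Matrix α α ℂ}
    (hV : V ∈ Matrix.unitaryGroup α ℂ) : Function.Injective fun P => V * P * Vᴴ := by
  have h : Vᴴ * V = 1 := Matrix.mem_unitaryGroup_iff'.1 hV
  refine Function.LeftInverse.injective (g := fun P => Vᴴ * P * V) fun P => ?_
  simp only
  rw [Matrix.mul_assoc V, ← Matrix.mul_assoc Vᴴ V, h, Matrix.one_mul, Matrix.mul_assoc, h,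
    Matrix.mul_one]

/-- Conjugation is multiplicative and injective. Once it sends the finite Pauli group into itself it
is onto by counting, so images of generators suffice. -/
theorem isClifford_of_generators {V : QOp n} (hV : V ∈ Matrix.unitaryGroup (BinVec n) ℂ)
    (hX : ∀ f, V * pw gateX f * Vᴴ ∈ pauliGroup n) (hZ : ∀ f, V * pw gateZ f * Vᴴ ∈ pauliGroup n) :
    IsClifford V := by
  refine ⟨hV, Set.eq_of_subset_of_ncard_le ?_
    (Set.ncard_image_of_injective _ (conj_injective hV)).ge finite_pauliGroup⟩
  rintro _ ⟨P, hP, rfl⟩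
  obtain ⟨ω, f, g, rfl⟩ := mem_pauliGroup_iff.1 hP
  simp only
  rw [Matrix.mul_smul, Matrix.smul_mul, conj_mul_conj hV]
  exact I_pow_smul_mem_pauliGroup (mul_mem_pauliGroup (hX f) (hZ g)) ω

theorem isClifford_one : IsClifford (1 : QOp n) :=
  ⟨one_mem _, by simp⟩

theorem IsClifford.mul {V W : QOp n} (hV : IsClifford V) (hW : IsClifford W) :
    IsClifford (V * W) := by
  refine ⟨mul_mem hV.1 hW.1, ?_⟩
  have h : (fun P => V * W * P * (V * W)ᴴ) = (fun P => V * P * Vᴴ) ∘ fun P => W * P * Wᴴ := by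
    funext P
    simp only [Function.comp_apply, Matrix.conjTranspose_mul, Matrix.mul_assoc]
  rw [h, Set.image_comp, hW.2, hV.2]

theorem tensorOp_mem_unitaryGroup {V : Fin n → Gate}
    (hV : ∀ j, V j ∈ Matrix.unitaryGroup (ZMod 2) ℂ) :
    tensorOp V ∈ Matrix.unitaryGroup (BinVec n) ℂ := by
  rw [Matrix.mem_unitaryGroup_iff, Matrix.star_eq_conjTranspose, tensorOp_conjTranspose,
    tensorOp_mul, ← tensorOp_one]
  congr 1
  funext j
  exact Matrix.mem_unitaryGroup_iff.1 (hV j)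

/-- A tensor product of one-qubit Clifford operators is a Clifford operator. -/
theorem isClifford_tensorOp {V : Fin n → Gate} (hV : ∀ j, V j ∈ Matrix.unitaryGroup (ZMod 2) ℂ)
    (hX : ∀ j, V j * gateX * (V j)ᴴ ∈ gatePauli) (hZ : ∀ j, V j * gateZ * (V j)ᴴ ∈ gatePauli) :
    IsClifford (tensorOp V) := by
  have h : ∀ O : Gate, (∀ j, V j * O * (V j)ᴴ ∈ gatePauli) → ∀ f : BinVec n,
      tensorOp V * pw O f * (tensorOp V)ᴴ ∈ pauliGroup n := by
    intro O hO f
    rw [pw, tensorOp_conjTranspose, tensorOp_mul, tensorOp_mul]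
    refine mem_pauliGroup_iff_gatePauli.2 ⟨0, _, fun j => ?_, by rw [pow_zero, one_smul]⟩
    rcases zmod_two_cases (f j) with h | h
    · rw [h, ZMod.val_zero, pow_zero, Matrix.mul_one, ← Matrix.star_eq_conjTranspose,
        Matrix.mem_unitaryGroup_iff.1 (hV j)]
      exact ⟨0, 0, 0, by simp⟩
    · rw [h, ZMod.val_one, pow_one]
      exact hO j
  exact isClifford_of_generators (tensorOp_mem_unitaryGroup hV) (h _ hX) (h _ hZ)

theorem gateX_mem_gatePauli : gateX ∈ gatePauli := ⟨0, 1, 0, by simp [ZMod.val_one]⟩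

theorem gateZ_mem_gatePauli : gateZ ∈ gatePauli := ⟨0, 0, 1, by simp [ZMod.val_one]⟩

theorem isClifford_pw {O : Gate} (hO : O ∈ Matrix.unitaryGroup (ZMod 2) ℂ)
    (hX : O * gateX * Oᴴ ∈ gatePauli) (hZ : O * gateZ * Oᴴ ∈ gatePauli) (f : BinVec n) :
    IsClifford (pw O f) := by
  refine isClifford_tensorOp (fun j => ?_) (fun j => ?_) fun j => ?_ <;>
    rcases zmod_two_cases (f j) with h | h <;>
    simp only [h, ZMod.val_zero, ZMod.val_one, pow_zero, pow_one, Matrix.one_mul,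
      Matrix.conjTranspose_one, Matrix.mul_one, one_mem, gateX_mem_gatePauli,
      gateZ_mem_gatePauli] <;>
    assumption

theorem gate_ext {P Q : Gate} (h00 : P 0 0 = Q 0 0) (h01 : P 0 1 = Q 0 1) (h10 : P 1 0 = Q 1 0)
    (h11 : P 1 1 = Q 1 1) : P = Q := by
  ext u v
  rcases zmod_two_cases u with rfl | rfl <;> rcases zmod_two_cases v with rfl | rfl <;> assumption

theorem gate_mul_apply (P Q : Gate) (u v : ZMod 2) :
    (P * Q) u v = P u 0 * Q 0 v + P u 1 * Q 1 v := by
  rw [Matrix.mul_apply, sum_zmod_two]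

/-! ### Clifford property of S, A, controlled-Z, linear permutations and Hadamard. -/

theorem isClifford_pw_gateS (f : BinVec n) : IsClifford (pw gateS f) := by
  refine isClifford_pw ?_ ⟨1, 1, 1, ?_⟩ ⟨0, 0, 1, ?_⟩ f
  · rw [Matrix.mem_unitaryGroup_iff]
    apply gate_ext <;> simp [gateS, Matrix.star_apply]
  all_goals
    apply gate_ext <;>
      simp [gateS, gateX, gateZ, ZMod.val_one]

theorem gateA_conjTranspose : gateAᴴ = gateA := by
  rw [gateA_eq, Matrix.conjTranspose_mul, Matrix.conjTranspose_mul,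
    Matrix.conjTranspose_conjTranspose, Matrix.mul_assoc]
  congr 2
  apply gate_ext <;> simp [gateX, Matrix.conjTranspose_apply]

theorem gateX_mul_self : gateX * gateX = 1 := by
  apply gate_ext <;> simp [gate_mul_apply, gateX]

theorem gateA_mul_self : gateA * gateA = 1 := by
  rw [gateA_eq, Matrix.mul_assoc (gateT * gateX), ← Matrix.mul_assoc gateTᴴ,
    ← Matrix.mul_assoc gateTᴴ, gateT_conjTranspose_mul, Matrix.one_mul, Matrix.mul_assoc,
    ← Matrix.mul_assoc gateX, gateX_mul_self, Matrix.one_mul, gateT_mul_conjTranspose]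

theorem isClifford_pw_gateA (f : BinVec n) : IsClifford (pw gateA f) := by
  have h2 := omega8_sq
  have h0 := omega8_ne_zero
  have h3 : omega8⁻¹ * omega8⁻¹ = -Complex.I := by rw [← mul_inv, ← sq, h2, Complex.inv_I]
  have hI := Complex.I_mul_I
  -- The witnesses encode AXA† = Y = iXZ and AZA† = -Z.
  refine isClifford_pw ?_ ⟨1, 1, 1, ?_⟩ ⟨2, 0, 1, ?_⟩ f
  · rw [Matrix.mem_unitaryGroup_iff, Matrix.star_eq_conjTranspose, gateA_conjTranspose,
      gateA_mul_self]
  all_goals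
    rw [gateA_conjTranspose]
    apply gate_ext <;>
      simp [gate_mul_apply, gateA, gateS, gateX, gateZ, ZMod.val_one]
  · linear_combination h3
  · linear_combination Complex.I * Complex.I * h3 - Complex.I * hI
  · linear_combination Complex.I * h3 - hI
  · linear_combination Complex.I * h3 - hI

/-- The inner product with a linear image is the inner product with some vector. -/
theorem exists_dotProduct_comp (L : BinVec n →ₗ[ZMod 2] BinVec n) (g : BinVec n) :
    ∃ g' : BinVec n, ∀ u, g' ⬝ᵥ u = g ⬝ᵥ L u :=
  exists_dotProduct_eq ((dotForm n g).comp L)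

theorem czOn_eq (p q : Fin n) : czOn p q = Matrix.diagonal fun u => sgn (u p * u q) := by
  rw [czOn]
  congr 1
  funext u
  rcases zmod_two_cases (u p) with h | h <;> rcases zmod_two_cases (u q) with h' | h' <;>
    simp [h, h']

theorem isClifford_czOn (p q : Fin n) : IsClifford (czOn p q) := by
  have hH : (czOn p q)ᴴ = czOn p q := by
    rw [czOn_eq, Matrix.diagonal_conjTranspose]
    congr 1
    funext u
    exact star_sgn _
  have h2 : czOn p q * czOn p q = 1 := by
    rw [czOn_eq, Matrix.diagonal_mul_diagonal, ← Matrix.diagonal_one]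
    congr 1
    funext u
    exact sgn_mul_self _
  refine isClifford_of_generators ?_ (fun f => ?_) fun g => ?_
  · rw [Matrix.mem_unitaryGroup_iff, Matrix.star_eq_conjTranspose, hH, h2]
  -- Expanding (u_p + f_p)(u_q + f_q) leaves a Z on one qubit for each X on the other, and the sign
  -- f_p f_q.
  · have h : czOn p q * pw gateX f * czOn p q = sgn (f p * f q) •
        (pw gateZ (Pi.single p (f q) + Pi.single q (f p)) * pw gateX f) := by
      apply Matrix.mulVec_injective
      funext ψ
      funext u
      simp only [czOn_eq, ← Matrix.mulVec_mulVec, Matrix.smul_mulVec, Matrix.mulVec_diagonal,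
        pw_gateX_mulVec, pw_gateZ_mulVec, Pi.smul_apply, smul_eq_mul, add_dotProduct,
        single_dotProduct, Pi.add_apply, ← mul_assoc, ← sgn_add]
      congr 2
      have h3 : u p * u q + u p * u q = 0 := CharTwo.add_self_eq_zero _
      linear_combination h3
    rw [hH, h]
    exact sgn_smul_mem_pauliGroup (mul_mem_pauliGroup (pw_gateZ_mem_pauliGroup _)
      (pw_gateX_mem_pauliGroup _)) _
  · have h : Commute (czOn p q) (pw gateZ g) := by
      rw [czOn, pw_gateZ]
      exact Matrix.commute_diagonal _ _
    rw [hH, h.eq, Matrix.mul_assoc, h2, Matrix.mul_one]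
    exact pw_gateZ_mem_pauliGroup g

theorem isClifford_of_mem_czsMonoid {U : QOp n} (hU : U ∈ czsMonoid n) : IsClifford U := by
  induction hU using Submonoid.closure_induction with
  | mem V hV =>
    rcases hV with ⟨p, rfl⟩ | ⟨p, q, -, rfl⟩
    · exact isClifford_pw_gateS _
    · exact isClifford_czOn p q
  | one => exact isClifford_one
  | mul V W _ _ hV hW => exact hV.mul hW

/-- The permutation of the computational basis by a linear map. -/
def linOp (L : BinVec n ≃ₗ[ZMod 2] BinVec n) : QOp n :=
  Matrix.of fun u v => if u = L v then 1 else 0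

theorem linOp_mulVec (L : BinVec n ≃ₗ[ZMod 2] BinVec n) (ψ : BinVec n → ℂ) (u : BinVec n) :
    (linOp L *ᵥ ψ) u = ψ (L.symm u) := by
  simp only [linOp, Matrix.mulVec, dotProduct, Matrix.of_apply, ite_mul, one_mul, zero_mul,
    ← LinearEquiv.symm_apply_eq, Finset.sum_ite_eq, Finset.mem_univ, if_true]

theorem linOp_conjTranspose (L : BinVec n ≃ₗ[ZMod 2] BinVec n) : (linOp L)ᴴ = linOp L.symm := by
  ext u v
  simp only [linOp, Matrix.conjTranspose_apply, Matrix.of_apply, apply_ite star, star_one,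
    star_zero, LinearEquiv.eq_symm_apply, eq_comm]

theorem isClifford_linOp (L : BinVec n ≃ₗ[ZMod 2] BinVec n) : IsClifford (linOp L) := by
  refine isClifford_of_generators ?_ (fun f => ?_) fun g => ?_
  · rw [Matrix.mem_unitaryGroup_iff, Matrix.star_eq_conjTranspose, linOp_conjTranspose]
    apply Matrix.mulVec_injective
    funext ψ
    funext u
    simp [← Matrix.mulVec_mulVec, linOp_mulVec]
  · have h : linOp L * pw gateX f * (linOp L)ᴴ = pw gateX (L f) := by
      rw [linOp_conjTranspose]
      apply Matrix.mulVec_injective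
      funext ψ
      funext u
      simp [← Matrix.mulVec_mulVec, linOp_mulVec, pw_gateX_mulVec]
    rw [h]
    exact pw_gateX_mem_pauliGroup _
  -- Z(g) goes to Z(g'), where `g'` is the transpose of `L⁻¹` applied to `g`.
  · obtain ⟨g', hg'⟩ := exists_dotProduct_comp L.symm.toLinearMap g
    have h : linOp L * pw gateZ g * (linOp L)ᴴ = pw gateZ g' := by
      rw [linOp_conjTranspose]
      apply Matrix.mulVec_injective
      funext ψ
      funext u
      simp [← Matrix.mulVec_mulVec, linOp_mulVec, pw_gateZ_mulVec, hg']
    rw [h]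
    exact pw_gateZ_mem_pauliGroup _

/-- The Hadamard gate. -/
noncomputable def gateH : Gate := Matrix.of fun u v => ((Real.sqrt 2)⁻¹ : ℝ) * sgn (u * v)

theorem sqrt_two_inv_mul_self :
    (((Real.sqrt 2)⁻¹ : ℝ) : ℂ) * (((Real.sqrt 2)⁻¹ : ℝ) : ℂ) = 1 / 2 := by
  rw [← Complex.ofReal_mul, ← mul_inv, Real.mul_self_sqrt zero_le_two]
  norm_num

theorem gateH_conjTranspose : gateHᴴ = gateH := by
  ext u v
  rw [Matrix.conjTranspose_apply, gateH, Matrix.of_apply, Matrix.of_apply, star_mul', star_sgn,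
    Complex.star_def, Complex.conj_ofReal, mul_comm v u]

theorem gateH_clifford : gateH ∈ Matrix.unitaryGroup (ZMod 2) ℂ ∧
    gateH * gateX * gateHᴴ ∈ gatePauli ∧ gateH * gateZ * gateHᴴ ∈ gatePauli := by
  have h := sqrt_two_inv_mul_self
  rw [Matrix.mem_unitaryGroup_iff, Matrix.star_eq_conjTranspose, gateH_conjTranspose]
  refine ⟨?_, ⟨0, 0, 1, ?_⟩, ⟨0, 1, 0, ?_⟩⟩ <;> apply gate_ext <;>
    simp only [gate_mul_apply, gateH, gateX, gateZ, ZMod.val_one, ZMod.val_zero, Matrix.of_apply,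
      mul_zero, mul_one, sgn_zero, sgn_one, pow_zero, pow_one, one_smul,
      Matrix.diagonal_apply, Matrix.one_apply, zero_ne_one, one_ne_zero, if_true, if_false,
      one_mul, zero_add, add_zero] <;>
    first
      | linear_combination 2 * h
      | linear_combination -2 * h
      | linear_combination 0 * h

end MagicDistillation

namespace MagicDistillation

variable {n k m : ℕ} {G : Matrix (Fin m) (Fin n) (ZMod 2)} {hk : k ≤ m}

/-! ### Diagonal operators composed of `Λ(Z)` and `S` gates -/

theorem diagonal_mul_mem_czsMonoid {f g : BinVec n → ℂ} (hf : Matrix.diagonal f ∈ czsMonoid n)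
    (hg : Matrix.diagonal g ∈ czsMonoid n) :
    Matrix.diagonal (fun u => f u * g u) ∈ czsMonoid n := by
  rw [← Matrix.diagonal_mul_diagonal]
  exact mul_mem hf hg

theorem diagonal_prod_mem_czsMonoid {α : Type*} (s : Finset α) {f : α → BinVec n → ℂ}
    (hf : ∀ i ∈ s, Matrix.diagonal (f i) ∈ czsMonoid n) :
    Matrix.diagonal (fun u => ∏ i ∈ s, f i u) ∈ czsMonoid n := by
  classical
  induction s using Finset.induction_on with
  | empty => simp [one_mem]
  | insert a s ha ih =>
    simp only [Finset.prod_insert ha]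
    exact diagonal_mul_mem_czsMonoid (hf a (Finset.mem_insert_self a s))
      (ih fun i hi => hf i (Finset.mem_insert_of_mem hi))

theorem exists_eq_I_pow {z : ℂ} (hz : z ^ 4 = 1) : ∃ t : ℕ, z = Complex.I ^ t := by
  have h1 : (z - 1) * (z + 1) * ((z - Complex.I) * (z + Complex.I)) = 0 := by
    linear_combination hz - (z ^ 2 - 1) * Complex.I_sq
  rcases mul_eq_zero.1 h1 with h1 | h1 <;> rcases mul_eq_zero.1 h1 with h1 | h1
  · exact ⟨0, by simpa using sub_eq_zero.1 h1⟩
  · exact ⟨2, by rw [Complex.I_sq]; exact eq_neg_of_add_eq_zero_left h1⟩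
  · exact ⟨1, by simpa using sub_eq_zero.1 h1⟩
  · exact ⟨3, by rw [Complex.I_pow_three]; exact eq_neg_of_add_eq_zero_left h1⟩

theorem sOn_eq (p : Fin n) :
    sOn p = Matrix.diagonal fun u : BinVec n => if u p = 0 then 1 else Complex.I := by
  simp only [sOn, pw, gateS_pow, tensorOp_diagonal]
  congr 1
  funext u
  rw [Finset.prod_eq_single p]
  · simp
  · intro j _ hj
    simp [hj]
  · simp

theorem diagonal_qubit_mem_czsMonoid (p : Fin n) {z : ℂ} (hz : z ^ 4 = 1) :
    (Matrix.diagonal fun u : BinVec n => if u p = 0 then 1 else z) ∈ czsMonoid n := by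
  obtain ⟨t, rfl⟩ := exists_eq_I_pow hz
  have h : sOn p ∈ czsMonoid n := Submonoid.subset_closure (Or.inl ⟨p, rfl⟩)
  have h2 := pow_mem h t
  rw [sOn_eq, Matrix.diagonal_pow] at h2
  have h3 : (fun u : BinVec n => if u p = 0 then 1 else Complex.I) ^ t =
      fun u => if u p = 0 then 1 else Complex.I ^ t := by
    funext u
    simp only [Pi.pow_apply]
    split_ifs <;> simp
  rwa [h3] at h2

theorem diagonal_pair_mem_czsMonoid {p q : Fin n} (hpq : p ≠ q) {z : ℂ} (hz : z ^ 2 = 1) :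
    (Matrix.diagonal fun u : BinVec n => if u p = 0 then 1 else if u q = 0 then 1 else z) ∈
      czsMonoid n := by
  rcases mul_self_eq_one_iff.1 ((sq z).symm.trans hz) with rfl | rfl
  · simp [one_mem]
  · have h : czOn p q ∈ czsMonoid n := Submonoid.subset_closure (Or.inr ⟨p, q, hpq, rfl⟩)
    convert h using 1
    rw [czOn]
    congr 1
    funext u
    rcases zmod_two_cases (u p) with h | h <;> rcases zmod_two_cases (u q) with h' | h' <;>
      simp [h, h']

/-- Quadratic phases are products of `Λ(Z)` and `S` gates. -/
theorem diagonal_mem_czsMonoid_of_quadratic {φ : BinVec n → ℂ} {c : BinVec n → BinVec n → ℂ}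
    (h4 : ∀ u, φ u ^ 4 = 1) (hφ : ∀ u v, φ (u + v) = φ u * φ v * c u v)
    (hc2 : ∀ u v, c u v ^ 2 = 1) (hc : ∀ u u' v, c (u + u') v = c u v * c u' v) :
    Matrix.diagonal φ ∈ czsMonoid n := by
  have hne : ∀ u, φ u ≠ 0 := fun u h => by simpa [h] using h4 u
  have hcne : ∀ u v, c u v ≠ 0 := fun u v h => by simpa [h] using hc2 u v
  have hc0 : ∀ v, c 0 v = 1 := fun v => by
    have h := hc 0 0 v
    rw [add_zero] at h
    exact (mul_eq_left₀ (hcne 0 v)).1 h.symm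
  have hsymm : ∀ u v, c u v = c v u := fun u v => by
    have h := hφ u v
    rw [add_comm, hφ v u, mul_comm (φ v)] at h
    exact (mul_left_cancel₀ (mul_ne_zero (hne u) (hne v)) h).symm
  have hφ0 : φ 0 = 1 := by
    have h := hφ 0 0
    rw [add_zero, hc0, mul_one] at h
    exact (mul_eq_left₀ (hne 0)).1 h.symm
  have hcsum : ∀ (s : Finset (Fin n)) (w : Fin n → BinVec n) v,
      c (∑ j ∈ s, w j) v = ∏ j ∈ s, c (w j) v := by
    intro s w v
    induction s using Finset.induction_on with
    | empty => simp [hc0]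
    | insert a s ha ih => rw [Finset.sum_insert ha, Finset.prod_insert ha, hc, ih]
  -- Coordinates are switched on one at a time. A new one adds its own fourth-root phase, a power of
  -- S, and a sign with each earlier coordinate, either trivial or a controlled-Z.
  have main : ∀ s : Finset (Fin n),
      Matrix.diagonal (fun u : BinVec n => φ (∑ j ∈ s, Pi.single j (u j))) ∈ czsMonoid n := by
    intro s
    induction s using Finset.induction_on with
    | empty => simp [hφ0, one_mem]
    | insert a s ha ih =>
      simp only [Finset.sum_insert ha, add_comm (Pi.single a _), hφ, hcsum]
      refine diagonal_mul_mem_czsMonoid (diagonal_mul_mem_czsMonoid ih ?_)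
        (diagonal_prod_mem_czsMonoid s fun j hj => ?_)
      · convert diagonal_qubit_mem_czsMonoid a (h4 (Pi.single a 1)) using 2
        funext u
        rcases zmod_two_cases (u a) with h | h <;> simp [h, hφ0]
      · have hja : j ≠ a := by
          rintro rfl
          exact ha hj
        convert diagonal_pair_mem_czsMonoid hja (hc2 (Pi.single j 1) (Pi.single a 1)) using 2
        funext u
        rcases zmod_two_cases (u j) with h | h <;> rcases zmod_two_cases (u a) with h' | h' <;>
          simp [h, h', hc0, hsymm _ 0]
  convert main Finset.univ using 2
  funext u
  rw [Finset.univ_sum_single]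

/-! ### The phase correction -/

/-- An identity of integers, not only modulo 2; it makes powers of the weight multiplicative up to
an overlap term. -/
theorem hammingNorm_add {α : Type*} [Fintype α] (f g : α → ZMod 2) :
    hammingNorm (f + g) + 2 * hammingNorm (f * g) = hammingNorm f + hammingNorm g := by
  classical
  simp only [hammingNorm, Finset.card_filter, Finset.mul_sum, ← Finset.sum_add_distrib]
  refine Finset.sum_congr rfl fun j _ => ?_
  simp only [Pi.add_apply, Pi.mul_apply]
  rcases zmod_two_cases (f j) with h | h <;> rcases zmod_two_cases (g j) with h' | h' <;>
    simp [h, h', show (1 + 1 : ZMod 2) = 0 from rfl]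

theorem pow_hammingNorm_add {α : Type*} [Fintype α] (z : ℂ) (f g : α → ZMod 2) :
    z ^ hammingNorm (f + g) * (z ^ 2) ^ hammingNorm (f * g) =
      z ^ hammingNorm f * z ^ hammingNorm g := by
  rw [← pow_mul, ← pow_add, ← pow_add, hammingNorm_add]

theorem eq_zero_of_mem_rowSpace {E : BinVec n → ZMod 2} (hE : ∀ f g, E (f + g) = E f + E g)
    (h : ∀ i, E (G i) = 0) {f : BinVec n} (hf : f ∈ rowSpace G) : E f = 0 := by
  have h0 : E 0 = 0 := by simpa using hE 0 0
  induction hf using Submodule.span_induction with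
  | mem x hx =>
    obtain ⟨i, rfl⟩ := hx
    exact h i
  | zero => exact h0
  | add x y _ _ hx hy => rw [hE, hx, hy, add_zero]
  | smul c x _ hx =>
    rcases zmod_two_cases c with rfl | rfl
    · rw [zero_smul, h0]
    · rw [one_smul, hx]

namespace Triorthogonal

theorem oddSyndrome_row (h : Triorthogonal G hk) (i : Fin m) (a : Fin k) :
    oddSyndrome G hk (G i) a = if i = Fin.castLE hk a then 1 else 0 := by
  rw [oddSyndrome, oddRow, h.row_dotProduct_row]
  refine if_congr ⟨And.left, fun hi => ⟨hi, ?_⟩⟩ rfl rfl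
  rw [hi]
  simp

/-- Repeated indices collapse the triple overlap to a pairwise one because t² = t. For distinct
indices the left side vanishes by triorthogonality, and the right side because no odd row is two
rows at once. -/
theorem sum_row_mul_row_mul_row (h : Triorthogonal G hk) (i j l : Fin m) :
    ∑ t, G i t * G j t * G l t =
      ∑ a, oddSyndrome G hk (G i) a * oddSyndrome G hk (G j) a * oddSyndrome G hk (G l) a := by
  have h2 : ∀ i j : Fin m, ∑ t, G i t * G j t =
      ∑ a, oddSyndrome G hk (G i) a * oddSyndrome G hk (G j) a := by
    intro i j
    refine (h.row_dotProduct_row i j).trans ?_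
    simp only [h.oddSyndrome_row]
    by_cases hi : (i : ℕ) < k
    · rw [Finset.sum_eq_single ⟨i, hi⟩]
      · have hc : Fin.castLE hk ⟨i, hi⟩ = i := rfl
        simp [hc, hi, eq_comm]
      · intro a _ ha
        rw [if_neg, zero_mul]
        rintro rfl
        exact ha rfl
      · simp
    · rw [if_neg fun h' => hi h'.2, eq_comm]
      refine Finset.sum_eq_zero fun a _ => ?_
      rw [if_neg, zero_mul]
      rintro rfl
      exact hi a.2
  by_cases hij : i = j
  · subst hij
    simpa only [zmod_two_mul_self] using h2 i l
  by_cases hjl : j = l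
  · subst hjl
    simpa only [mul_assoc, zmod_two_mul_self] using h2 i j
  by_cases hil : i = l
  · subst hil
    simpa only [mul_right_comm, zmod_two_mul_self] using h2 i j
  have hR : ∑ a, oddSyndrome G hk (G i) a * oddSyndrome G hk (G j) a *
      oddSyndrome G hk (G l) a = 0 := by
    refine Finset.sum_eq_zero fun a _ => ?_
    simp only [h.oddSyndrome_row]
    split_ifs with h1 h2 <;> simp_all
  rw [hR]
  have h3 := h.tri.2
  rcases lt_or_gt_of_ne hij with h1 | h1 <;> rcases lt_or_gt_of_ne hjl with h2 | h2 <;>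
    rcases lt_or_gt_of_ne hil with h4 | h4
  · simpa using h3 i j l h1 h2
  · exact absurd (h1.trans h2) (lt_asymm h4)
  · simpa [mul_comm, mul_left_comm] using h3 i l j h4 h2
  · simpa [mul_comm, mul_left_comm] using h3 l i j h4 h1
  · simpa [mul_comm, mul_left_comm] using h3 j i l h1 h4
  · simpa [mul_comm, mul_left_comm] using h3 j l i h2 h4
  · exact absurd (h2.trans h1) (lt_asymm h4)
  · simpa [mul_comm, mul_left_comm] using h3 l j i h2 h1

/-- Triple overlaps in the row space only come from the odd rows. -/
theorem sum_mul_mul (h : Triorthogonal G hk) {f g l : BinVec n} (hf : f ∈ rowSpace G)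
    (hg : g ∈ rowSpace G) (hl : l ∈ rowSpace G) :
    ∑ t, f t * g t * l t =
      ∑ a, oddSyndrome G hk f a * oddSyndrome G hk g a * oddSyndrome G hk l a := by
  -- The difference of the two sides is additive in each argument, so it need only vanish on rows.
  let E : BinVec n → BinVec n → BinVec n → ZMod 2 := fun f g l => ∑ t, f t * g t * l t -
    ∑ a, oddSyndrome G hk f a * oddSyndrome G hk g a * oddSyndrome G hk l a
  have h1 : ∀ f f' g l, E (f + f') g l = E f g l + E f' g l := fun f f' g l => by
    simp only [E, oddSyndrome_add, Pi.add_apply, add_mul, Finset.sum_add_distrib]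
    ring
  have h2 : ∀ f g g' l, E f (g + g') l = E f g l + E f g' l := fun f g g' l => by
    simp only [E, oddSyndrome_add, Pi.add_apply, add_mul, mul_add, Finset.sum_add_distrib]
    ring
  have h3 : ∀ f g l l', E f g (l + l') = E f g l + E f g l' := fun f g l l' => by
    simp only [E, oddSyndrome_add, Pi.add_apply, mul_add, Finset.sum_add_distrib]
    ring
  refine sub_eq_zero.1 (?_ : E f g l = 0)
  refine eq_zero_of_mem_rowSpace (E := fun f => E f g l) (fun _ _ => h1 _ _ _ _) (fun i => ?_) hf
  refine eq_zero_of_mem_rowSpace (E := fun g => E (G i) g l) (fun _ _ => h2 _ _ _ _)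
    (fun j => ?_) hg
  refine eq_zero_of_mem_rowSpace (E := fun l => E (G i) (G j) l) (fun _ _ => h3 _ _ _ _)
    (fun r => ?_) hl
  exact sub_eq_zero.2 (h.sum_row_mul_row_mul_row i j r)

theorem sum_mul (h : Triorthogonal G hk) {f g : BinVec n} (hf : f ∈ rowSpace G)
    (hg : g ∈ rowSpace G) :
    ∑ t, f t * g t = ∑ a, oddSyndrome G hk f a * oddSyndrome G hk g a := by
  simpa only [mul_assoc, zmod_two_mul_self] using h.sum_mul_mul hf hg hg

end Triorthogonal

theorem neg_one_pow_hammingNorm {α : Type*} [Fintype α] (f : α → ZMod 2) :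
    (-1 : ℂ) ^ hammingNorm f = sgn (∑ t, f t) := by
  rw [← natCast_hammingNorm, sgn_natCast]

/-- On `u` in 𝒢 the correction must be ω^{|x| - |u|}, with x the odd syndrome of `u`. The parities
of single, double and triple overlaps agree for `u` and for x; they give respectively φ⁴ = 1, c² = 1
and additivity of c. -/
theorem exists_isPhaseCorrection (h : Triorthogonal G hk) :
    ∃ U : QOp n, IsPhaseCorrection G hk U := by
  classical
  -- The phase is prescribed only on 𝒢; a linear projection onto 𝒢 extends it to all strings and
  -- keeps it quadratic.
  obtain ⟨π, hπ⟩ := (rowSpace G).subtype.exists_leftInverse_of_injective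
    (by rw [Submodule.ker_subtype])
  have hπ' : ∀ u (hu : u ∈ rowSpace G), (π u : BinVec n) = u := fun u hu =>
    congrArg Subtype.val (LinearMap.congr_fun hπ ⟨u, hu⟩)
  let x : BinVec n → BinVec k := fun u => oddSyndrome G hk (π u)
  let φ : BinVec n → ℂ := fun u =>
    omega8 ^ hammingNorm (x u) * omega8⁻¹ ^ hammingNorm (π u : BinVec n)
  -- The defect of multiplicativity of φ, read off from |f + g| = |f| + |g| - 2|fg| with ω² = i.
  let c : BinVec n → BinVec n → ℂ := fun u v =>
    (-Complex.I) ^ hammingNorm (x u * x v) *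
      Complex.I ^ hammingNorm ((π u : BinVec n) * (π v : BinVec n))
  have hx : ∀ u v, x (u + v) = x u + x v := fun u v => by
    simp only [x, map_add, Submodule.coe_add, oddSyndrome_add]
  have hp : ∀ u v, (π (u + v) : BinVec n) = π u + π v := fun u v => by
    rw [map_add, Submodule.coe_add]
  have hw2 : omega8⁻¹ ^ 2 = -Complex.I := by rw [inv_pow, omega8_sq, Complex.inv_I]
  have hI1 : Complex.I ^ 2 = -1 := Complex.I_sq
  have hI2 : (-Complex.I) ^ 2 = -1 := by rw [neg_sq, hI1]
  have hII : -Complex.I * Complex.I = 1 := by rw [neg_mul, Complex.I_mul_I, neg_neg]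
  have hII' : ∀ a : ℕ, (-Complex.I) ^ a * Complex.I ^ a = 1 := fun a => by
    rw [← mul_pow, hII, one_pow]
  have h4 : ∀ u, φ u ^ 4 = 1 := by
    intro u
    have e1 : (-1 : ℂ) ^ hammingNorm (x u) = (-1) ^ hammingNorm (π u : BinVec n) := by
      have := h.sum_mul (π u).2 (π u).2
      simp only [zmod_two_mul_self] at this
      rw [neg_one_pow_hammingNorm, neg_one_pow_hammingNorm, this]
    have e2 : omega8 ^ 4 = -1 := by rw [show 4 = 2 * 2 from rfl, pow_mul, omega8_sq, hI1]
    have e3 : omega8⁻¹ ^ 4 = -1 := by rw [inv_pow, e2]; norm_num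
    simp only [φ]
    rw [mul_pow, pow_right_comm, pow_right_comm omega8⁻¹, e2, e3, e1, ← mul_pow]
    norm_num
  have hφ : ∀ u v, φ (u + v) = φ u * φ v * c u v := by
    intro u v
    have e1 := pow_hammingNorm_add omega8 (x u) (x v)
    have e2 := pow_hammingNorm_add omega8⁻¹ (π u : BinVec n) (π v : BinVec n)
    rw [omega8_sq] at e1
    rw [hw2] at e2
    have e3 := hII' (hammingNorm (x u * x v))
    have e4 := hII' (hammingNorm ((π u : BinVec n) * (π v : BinVec n)))
    simp only [φ, c, hx, hp]
    generalize omega8 ^ hammingNorm (x u + x v) = A at *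
    generalize omega8⁻¹ ^ hammingNorm ((π u : BinVec n) + (π v : BinVec n)) = B at *
    generalize Complex.I ^ hammingNorm (x u * x v) = C at *
    generalize (-Complex.I) ^ hammingNorm (x u * x v) = C' at *
    generalize Complex.I ^ hammingNorm ((π u : BinVec n) * (π v : BinVec n)) = D at *
    generalize (-Complex.I) ^ hammingNorm ((π u : BinVec n) * (π v : BinVec n)) = D' at *
    calc A * B = (A * C) * (B * D') * (C' * D) := by
          linear_combination -A * B * e3 - A * B * C' * C * e4
      _ = _ := by
          rw [e1, e2]
          ring
  have hc2 : ∀ u v, c u v ^ 2 = 1 := by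
    intro u v
    have e1 : (-1 : ℂ) ^ hammingNorm (x u * x v) =
        (-1) ^ hammingNorm ((π u : BinVec n) * (π v : BinVec n)) := by
      rw [neg_one_pow_hammingNorm, neg_one_pow_hammingNorm]
      exact congrArg sgn (h.sum_mul (π u).2 (π v).2).symm
    simp only [c]
    rw [mul_pow, pow_right_comm, pow_right_comm Complex.I, hI1, hI2, e1, ← mul_pow]
    norm_num
  have hc : ∀ u u' v, c (u + u') v = c u v * c u' v := by
    intro u u' v
    have e1 := pow_hammingNorm_add (-Complex.I) (x u * x v) (x u' * x v)
    have e2 := pow_hammingNorm_add Complex.I ((π u : BinVec n) * (π v : BinVec n))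
      ((π u' : BinVec n) * (π v : BinVec n))
    have e3 : (-1 : ℂ) ^ hammingNorm (x u * x v * (x u' * x v)) = (-1) ^ hammingNorm
        ((π u : BinVec n) * (π v : BinVec n) * ((π u' : BinVec n) * (π v : BinVec n))) := by
      rw [neg_one_pow_hammingNorm, neg_one_pow_hammingNorm]
      have e4 := h.sum_mul_mul (π u).2 (π u').2 (π v).2
      have e5 : ∀ a b c : ZMod 2, a * c * (b * c) = a * b * c := by decide
      simp only [Pi.mul_apply, e5]
      exact congrArg sgn e4.symm
    rw [hI2, e3] at e1
    rw [hI1] at e2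
    have e6 : (-1 : ℂ) ^ hammingNorm ((π u : BinVec n) * (π v : BinVec n) *
        ((π u' : BinVec n) * (π v : BinVec n))) * (-1 : ℂ) ^ hammingNorm ((π u : BinVec n) *
        (π v : BinVec n) * ((π u' : BinVec n) * (π v : BinVec n))) = 1 := by
      rw [← mul_pow]
      norm_num
    simp only [c, hx, hp, add_mul]
    rw [mul_mul_mul_comm, ← e1, ← e2, mul_mul_mul_comm, e6, mul_one]
  refine ⟨Matrix.diagonal φ, diagonal_mem_czsMonoid_of_quadratic h4 hφ hc2 hc, ?_⟩
  funext u
  rw [Matrix.mulVec_diagonal, tensorOp_gateT, Matrix.mulVec_diagonal, encodedA_eq,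
    Finset.sum_apply]
  simp only [Pi.smul_apply, encodedBasis_apply, ketSpace, h.mem_evenSpace_iff, smul_eq_mul,
    mul_ite, mul_one, mul_zero, ite_and]
  -- A string of 𝒢 lies in exactly one coset of 𝒢₀, so one term survives; outside 𝒢 both sides
  -- vanish.
  split_ifs with hu
  · simp only [φ, x, hπ' u hu, Finset.sum_ite_eq, Finset.mem_univ, if_true]
    rw [mul_assoc, ← mul_pow, inv_mul_cancel₀ omega8_ne_zero, one_pow, mul_one]
  · simp

end MagicDistillation

namespace MagicDistillation

variable {n k m : ℕ} {G : Matrix (Fin m) (Fin n) (ZMod 2)} {hk : k ≤ m}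

/-! ### The decoder -/

theorem oddComb_single (a : Fin k) : oddComb G hk (Pi.single a 1) = oddRow G hk a := by
  simp [oddComb, Pi.single_apply]

/-- A basis of the row space consisting of the odd rows and a basis of the even space. -/
noncomputable def Triorthogonal.rowSpaceBasis (h : Triorthogonal G hk) {r : ℕ}
    (b : Module.Basis (Fin r) (ZMod 2) (evenSpace G)) :
    Module.Basis (Fin k ⊕ Fin r) (ZMod 2) (rowSpace G) :=
  ((Pi.basisFun (ZMod 2) (Fin k)).prod b).map h.rowSpaceEquiv.symm

theorem Triorthogonal.rowSpaceBasis_inl (h : Triorthogonal G hk) {r : ℕ}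
    (b : Module.Basis (Fin r) (ZMod 2) (evenSpace G)) (a : Fin k) :
    (h.rowSpaceBasis b (Sum.inl a) : BinVec n) = oddRow G hk a := by
  simp only [rowSpaceBasis, Module.Basis.map_apply]
  change (((Pi.basisFun (ZMod 2) (Fin k)).prod b (Sum.inl a)).2 : BinVec n) +
    oddComb G hk ((Pi.basisFun (ZMod 2) (Fin k)).prod b (Sum.inl a)).1 = _
  simp [oddComb_single]

theorem Triorthogonal.rowSpaceBasis_inr (h : Triorthogonal G hk) {r : ℕ}
    (b : Module.Basis (Fin r) (ZMod 2) (evenSpace G)) (i : Fin r) :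
    (h.rowSpaceBasis b (Sum.inr i) : BinVec n) = b i := by
  simp only [rowSpaceBasis, Module.Basis.map_apply]
  change (((Pi.basisFun (ZMod 2) (Fin k)).prod b (Sum.inr i)).2 : BinVec n) +
    oddComb G hk ((Pi.basisFun (ZMod 2) (Fin k)).prod b (Sum.inr i)).1 = _
  simp

/-- Indexing the extended basis by `Fin n` assigns a qubit to each basis vector; `e` names the
qubits of the given family. -/
theorem exists_basis_extending {κ : Type*} {v : κ → BinVec n}
    (hv : LinearIndependent (ZMod 2) v) :
    ∃ (e : κ ↪ Fin n) (B : Module.Basis (Fin n) (ZMod 2) (BinVec n)), ∀ i, B (e i) = v i := by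
  let B := Module.Basis.extend hv.linearIndepOn_id
  have := FiniteDimensional.fintypeBasisIndex B
  let E := Fintype.equivOfCardEq ((Module.finrank_eq_card_basis B).symm.trans
    (Module.finrank_eq_card_basis (Pi.basisFun (ZMod 2) (Fin n))))
  have hmem : ∀ i, v i ∈ hv.linearIndepOn_id.extend (Set.subset_univ _) := fun i =>
    Module.Basis.subset_extend hv.linearIndepOn_id ⟨i, rfl⟩
  refine ⟨⟨fun i => E ⟨v i, hmem i⟩, fun i j hij =>
    hv.injective (congrArg Subtype.val (E.injective hij))⟩, B.reindex E, fun i => ?_⟩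
  rw [Module.Basis.reindex_apply]
  change B (E.symm (E ⟨v i, hmem i⟩)) = v i
  rw [Equiv.symm_apply_apply]
  exact Module.Basis.extend_apply_self _ _

/-- The odd rows and a basis of the even space extend to a basis of the space. -/
theorem Triorthogonal.exists_basis (h : Triorthogonal G hk) {r : ℕ}
    (b : Module.Basis (Fin r) (ZMod 2) (evenSpace G)) :
    ∃ (e : Fin k ⊕ Fin r ↪ Fin n) (B : Module.Basis (Fin n) (ZMod 2) (BinVec n)),
      (∀ a, B (e (Sum.inl a)) = oddRow G hk a) ∧ ∀ i, B (e (Sum.inr i)) = b i := by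
  obtain ⟨e, B, hB⟩ := exists_basis_extending
    ((h.rowSpaceBasis b).linearIndependent.map' (rowSpace G).subtype (Submodule.ker_subtype _))
  exact ⟨e, B, fun a => (hB _).trans (h.rowSpaceBasis_inl b a),
    fun i => (hB _).trans (h.rowSpaceBasis_inr b i)⟩

theorem prod_boole_fin (p : Fin n → Prop) [∀ j, Decidable (p j)] [Decidable (∀ j, p j)] :
    ∏ j, (if p j then (1 : ℂ) else 0) = if ∀ j, p j then 1 else 0 := by
  simp [Finset.prod_boole]

theorem gateH_mulVec_const :
    gateH *ᵥ (fun _ => 1) = fun t => if t = 0 then (Real.sqrt 2 : ℂ) else 0 := by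
  have h : (((Real.sqrt 2)⁻¹ : ℝ) : ℂ) * 2 = Real.sqrt 2 := by
    have h1 : (Real.sqrt 2 : ℂ) ≠ 0 := Complex.ofReal_ne_zero.2 (Real.sqrt_pos.2 zero_lt_two).ne'
    have h2 : (Real.sqrt 2 : ℂ) * Real.sqrt 2 = 2 := by
      rw [← Complex.ofReal_mul, Real.mul_self_sqrt zero_le_two, Complex.ofReal_ofNat]
    rw [← h2, Complex.ofReal_inv, ← mul_assoc, inv_mul_cancel₀ h1, one_mul]
  funext t
  rw [Matrix.mulVec, dotProduct, sum_zmod_two]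
  rcases zmod_two_cases t with rfl | rfl
  · simp only [gateH, Matrix.of_apply, zero_mul, sgn_zero, mul_one, if_true]
    linear_combination h
  · simp [gateH]

/-- In coordinates of a basis extending the odd rows and a basis of 𝒢₀, an encoded basis state is
|x⟩ on the qubits of the odd rows, a uniform superposition on those of 𝒢₀, and |0⟩ elsewhere.
Hadamard gates on the qubits of 𝒢₀ return them to |0⟩. -/
theorem Triorthogonal.exists_isDecoder (h : Triorthogonal G hk) :
    ∃ (ι : Fin k ↪ Fin n) (D : QOp n), IsDecoder G hk ι D := by
  classical
  let b := Module.finBasis (ZMod 2) (evenSpace G)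
  obtain ⟨e, B, hB1, hB2⟩ := h.exists_basis b
  let L : BinVec n ≃ₗ[ZMod 2] BinVec n := B.equivFun
  let ι : Fin k ↪ Fin n := Function.Embedding.inl.trans e
  let s : Finset (Fin n) := Finset.univ.map (Function.Embedding.inr.trans e)
  have hs : ∀ j, j ∈ s ↔ ∃ i, e (Sum.inr i) = j := fun j => by simp [s]
  have hιs : ∀ a, ι a ∉ s := fun a ha => by
    obtain ⟨i, hi⟩ := (hs _).1 ha
    exact Sum.inr_ne_inl (e.injective hi)
  have hLodd : ∀ x, L (oddComb G hk x) = padZero ι x := by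
    intro x
    have h1 : ∀ a j, L (oddRow G hk a) j = if ι a = j then 1 else 0 := fun a j => by
      rw [← hB1]
      exact B.equivFun_self _ _
    funext j
    rw [oddComb, map_sum, Finset.sum_apply]
    simp only [map_smul, Pi.smul_apply, h1, smul_eq_mul, mul_ite, mul_one, mul_zero]
    by_cases hj : j ∈ Set.range ι
    · obtain ⟨a, rfl⟩ := hj
      simp [padZero_apply]
    · rw [padZero_apply_of_notMem ι x hj]
      exact Finset.sum_eq_zero fun a _ => if_neg fun ha => hj ⟨a, ha⟩
  have hLeven : ∀ u : BinVec n, L.symm u ∈ evenSpace G ↔ ∀ j, j ∉ s → u j = 0 := by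
    intro u
    constructor
    · have h1 : ∀ g ∈ evenSpace G, ∀ j, j ∉ s → L g j = 0 := by
        intro g hg j hj
        rw [← basis_span b] at hg
        induction hg using Submodule.span_induction with
        | mem x hx =>
          obtain ⟨i, rfl⟩ := hx
          simp only
          rw [← hB2]
          exact (B.equivFun_self _ _).trans (if_neg fun hi => hj ((hs j).2 ⟨i, hi⟩))
        | zero => rw [map_zero, Pi.zero_apply]
        | add x y _ _ hx hy => rw [map_add, Pi.add_apply, hx, hy, add_zero]
        | smul c x _ hx => rw [map_smul, Pi.smul_apply, hx, smul_zero]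
      intro hu j hj
      simpa using h1 _ hu j hj
    · intro hu
      rw [Module.Basis.equivFun_symm_apply]
      refine Submodule.sum_mem _ fun j _ => ?_
      by_cases hj : j ∈ s
      · obtain ⟨i, rfl⟩ := (hs j).1 hj
        rw [hB2]
        exact Submodule.smul_mem _ _ (b i).2
      · rw [hu j hj, zero_smul]
        exact zero_mem _
  let V : Fin n → Gate := fun j => if j ∈ s then gateH else 1
  have hV : IsClifford (tensorOp V) := by
    refine isClifford_tensorOp (fun j => ?_) (fun j => ?_) fun j => ?_ <;> by_cases hj : j ∈ s <;>
      simp [V, hj, gateH_clifford, gateX_mem_gatePauli, gateZ_mem_gatePauli, one_mem]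
  refine ⟨ι, tensorOp V * linOp L, hV.mul (isClifford_linOp L), fun x => ?_⟩
  let ψ : Fin n → ZMod 2 → ℂ := fun j t =>
    if j ∈ s then 1 else if t = padZero ι x j then 1 else 0
  have hpad : ∀ j ∈ s, padZero ι x j = 0 := fun j hj =>
    padZero_apply_of_notMem ι x fun ⟨a, ha⟩ => hιs a (ha ▸ hj)
  have h1 : linOp L *ᵥ encodedBasis G hk x = fun u => ∏ j, ψ j (u j) := by
    funext u
    have h2 : L.symm u + oddComb G hk x = L.symm (u + padZero ι x) := by
      rw [map_add, ← hLodd, LinearEquiv.symm_apply_apply]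
    have h3 : ∀ j, ψ j (u j) = if j ∉ s → u j = padZero ι x j then 1 else 0 := fun j => by
      by_cases hj : j ∈ s <;> simp [ψ, hj]
    rw [linOp_mulVec, encodedBasis_apply, ketSpace, h2, Finset.prod_congr rfl fun j _ => h3 j,
      prod_boole_fin]
    refine if_congr ((hLeven _).trans (forall_congr' fun j => imp_congr_right fun _ => ?_)) rfl rfl
    rw [Pi.add_apply, CharTwo.add_eq_zero]
  have h2 : ∀ j, V j *ᵥ ψ j = fun t =>
      (if j ∈ s then (Real.sqrt 2 : ℂ) else 1) * if t = padZero ι x j then 1 else 0 := by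
    intro j
    by_cases hj : j ∈ s
    · simp only [V, ψ, if_pos hj, gateH_mulVec_const, hpad j hj]
      funext t
      rw [mul_ite, mul_one, mul_zero]
    · simp only [V, ψ, if_neg hj, Matrix.one_mulVec, one_mul]
  have hcard : s.card = Module.finrank (ZMod 2) (evenSpace G) := by
    rw [Finset.card_map, Finset.card_univ, Fintype.card_fin]
  have h0 : (Real.sqrt 2) ^ s.card ≠ 0 := pow_ne_zero _ (Real.sqrt_pos.2 zero_lt_two).ne'
  rw [Matrix.mulVec_smul, ← Matrix.mulVec_mulVec, h1, tensorOp_mulVec]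
  funext u
  simp only [h2]
  -- Each Hadamard contributes √2, and together they cancel √|𝒢₀| = (√2)^{|s|}.
  rw [Pi.smul_apply, Finset.prod_mul_distrib, prod_boole_fin, Finset.prod_ite_mem,
    Finset.univ_inter, Finset.prod_const, natCard_submodule, ← hcard, Nat.cast_pow,
    Nat.cast_ofNat, Real.sqrt_eq_rpow, ← Real.rpow_natCast_mul, mul_comm (s.card : ℝ),
    Real.rpow_mul_natCast, ← Real.sqrt_eq_rpow, ketBasis, Pi.single_apply, Complex.real_smul,
    ← Complex.ofReal_pow, ← mul_assoc, ← Complex.ofReal_mul, inv_mul_cancel₀ h0,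
    Complex.ofReal_one, one_mul]
  · exact if_congr funext_iff.symm rfl rfl
  all_goals norm_num

end MagicDistillation

/-! ### Existence of the choices and the final theorem. -/

namespace MagicDistillation

variable {n k m : ℕ} {G : Matrix (Fin m) (Fin n) (ZMod 2)} {hk : k ≤ m}

theorem AltChoices.nonempty (h : Triorthogonal G hk) : Nonempty (AltChoices G hk) := by
  obtain ⟨U, hU⟩ := exists_isPhaseCorrection h
  obtain ⟨ι, D, hD⟩ := h.exists_isDecoder
  let z := Module.finBasis (ZMod 2) (dualSpace (rowSpace G))
  choose w hw using exists_syndrome z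
  exact ⟨⟨_, z, _, Module.finBasis (ZMod 2) (evenSpace G), w, hw, U, hU, ι, D, hD⟩⟩

theorem AltChoices.usesOnlyClifford_protocol (C : AltChoices G hk) :
    C.protocol.UsesOnlyClifford := by
  refine Protocol.usesOnlyClifford_measureAll _ _ _
    (fun i => ⟨pw_gateZ_mem_pauliGroup _, pw_gateZ_isHermitian _⟩) fun μ => ⟨?_, ?_, ?_⟩
  · rw [(pw_gateA_isHermitian _).eq]
    exact isClifford_pw_gateA _
  · exact isClifford_of_mem_czsMonoid C.U_spec.1
  · refine Protocol.usesOnlyClifford_measureAll _ _ _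
      (fun i => ⟨pw_gateX_mem_pauliGroup _, pw_gateX_isHermitian _⟩) fun ν => ?_
    split_ifs
    · exact ⟨C.D_spec.1, trivial⟩
    · trivial

theorem AltChoices.run_afterSyndrome_normalized (C : AltChoices G hk) (h : Triorthogonal G hk)
    (p : ℝ) (μ : BinVec C.d) :
    (C.afterSyndrome μ).run ((C.syndromeProj μ * rawInput n p * C.syndromeProj μ).trace⁻¹ •
      (C.syndromeProj μ * rawInput n p * C.syndromeProj μ)) =
      ∑ x, (pOut G hk p x : ℂ) • ketbra (ketAx x) := by
  rw [Protocol.run_smul, C.run_afterSyndrome h, C.trace_syndromeProj, smul_smul, inv_inv,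
    mul_inv_cancel₀ (pow_ne_zero _ two_ne_zero), one_smul]

end MagicDistillation

open Classical in
theorem mainTheorem5 {m n k : ℕ} (G : Matrix (Fin m) (Fin n) (ZMod 2)) (hG : IsTriorthogonal G)
    (hk : k ≤ m) (hodd : ∀ i : Fin m, Odd (hammingNorm (G i)) ↔ (i : ℕ) < k) :
    -- The protocol exists: all choices that it involves can be made.
    Nonempty (AltChoices G hk) ∧
    -- Whatever choices are made, it has the following properties.
    ∀ C : AltChoices G hk,
      C.protocol.UsesOnlyClifford ∧
      C.protocol.numMeasurements + k = n ∧
      ∀ p : ℝ, 0 ≤ p → p ≤ 1 →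
        -- success probability and output state
        0 < Ps G p ∧
        Ps G p = (Nat.card (evenSpace G) : ℝ)⁻¹ *
          ∑ f : BinVec n with f ∈ evenSpace G, (1 - 2 * p) ^ hammingNorm f ∧
        C.protocol.successProb (rawInput n p) = (Ps G p : ℂ) ∧
        C.protocol.outputState (rawInput n p) = rhoOut G hk p ∧
        -- the same holds conditionally on every outcome of the syndrome measurement
        (∀ (μ : BinVec C.d) (σ : QOp n),
          σ = C.syndromeProj μ * rawInput n p * C.syndromeProj μ →
            σ.trace = ((2 : ℂ) ^ C.d)⁻¹ ∧
            (C.afterSyndrome μ).successProb (σ.trace⁻¹ • σ) = (Ps G p : ℂ) ∧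
            (C.afterSyndrome μ).outputState (σ.trace⁻¹ • σ) = rhoOut G hk p) ∧
        -- the main subroutine has the same success probability and output state
        (mainProtocol G hk C.U C.D C.ι).successProb (mainState G p) = (Ps G p : ℂ) ∧
        (mainProtocol G hk C.U C.D C.ι).outputState (mainState G p) = rhoOut G hk p := by
  have h : Triorthogonal G hk := ⟨hG, hodd⟩
  refine ⟨AltChoices.nonempty h, fun C => ⟨C.usesOnlyClifford_protocol,
    C.numMeasurements_protocol h, fun p _ _ => ?_⟩⟩
  have halt := Protocol.successProb_outputState h (C.run_protocol h p)
  -- The even rows need not be independent; spanning 𝒢₀ is enough for the post-selection.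
  have hmain := Protocol.successProb_outputState h
    (run_postselectAndDecode_mainState h h.evenSpace_eq_span C.U_spec C.D_spec p)
  refine ⟨Ps_pos h p, Ps_eq G p, halt.1, halt.2, ?_, hmain.1, hmain.2⟩
  rintro μ σ rfl
  exact ⟨C.trace_syndromeProj p μ,
    Protocol.successProb_outputState h (C.run_afterSyndrome_normalized h p μ)⟩
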